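/- All graphs are finite, simple and undirected. A set $S$ of vertices of a graph $G$ is a separator of $G$ if $G-S$ has more connected components than $G$; the graph $G$ is $3$-connected if it is connected and no set of exactly two vertices is a separator of $G$ (so, for instance, every complete graph with at least one vertex is $3$-connected). Connected graphs are taken to be non-empty. The $2$-dimensional Weisfeiler--Leman algorithm colours the pairs $(v_1,v_2)\in V(G)^2$ as follows. Initially, $\chi^0_G(v_1,v_2)$ records whether $v_1=v_2$ and whether $v_1v_2\in E(G)$; then $$\chi^{i+1}_G(v_1,v_2)=\Bigl(\chi^i_G(v_1,v_2),\ \{\!\!\{(\chi^i_G(w,v_2),\chi^i_G(v_1,w)) : w\in V(G)\}\!\!\}\Bigr).$$ The stable colouring $\chi_G$ is $\chi_G^i$ for the least $i$ such that $\chi_G^{i+1}$ induces the same partition of $V(G)^2$ as $\chi_G^i$. An association scheme on a finite set $V$ is an ordered partition $(R_0,\dots,R_d)$ of $V^2$ into non-empty relations such that $R_0=\{(v,v): v\in V\}$, for every $i\in\{0,\dots,d\}$ the transpose $R_i^{\top}$ is one of the $R_j$, and for all $i,j,k\in\{0,\dots,d\}$ the number $|\{x\in V:(v,x)\in R_i,\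 (w,x)\in R_j\}|$ is the same for all $(v,w)\in R_k$. The scheme need not be symmetric, i.e. $R_i^{\top}=R_i$ is not required. Its constituent graphs are the graphs $G(R_i)=(V,R_i\cup R_i^{\top})$, $0\le i\le d$, regarded as undirected graphs without loops. **Theorem.** (1) Let $G$ be a graph such that $\chi_G(u,u)=\chi_G(v,v)$ for all $u,v\in V(G)$. Then exactly one of the following holds: $G$ is not connected; $G$ is $3$-connected; $G$ is a cycle of length $\ell$ for some $\ell\ge 4$. (2) Every connected constituent graph of an association scheme is $3$-connected or a cycle of length at least $4$. -/

import Mathlib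

/-! ### Separators, 3-connectivity -/

namespace SimpleGraph

/-- A vertex set `S` separates `G` if `G - S` has more connected components than `G`
(for finite graphs). -/
def IsSeparator {V : Type*} (G : SimpleGraph V) (S : Finset V) : Prop :=
  Nat.card G.ConnectedComponent < Nat.card (G.induce ((S : Set V)ᶜ)).ConnectedComponent

/-- `G` is 3-connected if it is connected and no set of exactly two vertices separates it.
In particular complete graphs with at least one vertex are 3-connected. -/
def IsThreeConnected {V : Type*} (G : SimpleGraph V) : Prop :=
  G.Connected ∧ ¬ ∃ S : Finset V, S.card = 2 ∧ G.IsSeparator S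

/-- `G` is a cycle of length at least 4. -/
def IsCycleOfLengthGeFour {V : Type*} (G : SimpleGraph V) : Prop :=
  ∃ l : ℕ, 4 ≤ l ∧ Nonempty (G ≃g cycleGraph l)

/-! ### The 2-dimensional Weisfeiler-Leman algorithm -/

/-- The colours used after `i` rounds. Initially a pair `(v₁, v₂)` is coloured with its ordered
isomorphism type, recorded by the truth values of `v₁ = v₂` and of `v₁v₂ ∈ E(G)`. -/
def WLColor : ℕ → Type
  | 0 => Prop × Prop
  | i + 1 => WLColor i × Multiset (WLColor i × WLColor i)

/-- The colour of the pair `(v₁, v₂)` after `i` rounds. -/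
def wlColor {V : Type*} [Fintype V] (G : SimpleGraph V) : (i : ℕ) → V → V → WLColor i
  | 0 => fun v₁ v₂ => (v₁ = v₂, G.Adj v₁ v₂)
  | i + 1 => fun v₁ v₂ =>
      (wlColor G i v₁ v₂,
        (Finset.univ : Finset V).val.map fun w => (wlColor G i w v₂, wlColor G i v₁ w))

/-- The partition of the pairs after round `i + 1` is not strictly finer than after round `i`. -/
def WLStableAt {V : Type*} [Fintype V] (G : SimpleGraph V) (i : ℕ) : Prop :=
  ∀ v₁ v₂ w₁ w₂ : V, G.wlColor i v₁ v₂ = G.wlColor i w₁ w₂ →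
    G.wlColor (i + 1) v₁ v₂ = G.wlColor (i + 1) w₁ w₂

theorem exists_wlStableAt {V : Type*} [Fintype V] (G : SimpleGraph V) :
    ∃ i, G.WLStableAt i := by
  let f : ℕ → (Set ((V × V) × (V × V)))ᵒᵈ := fun i =>
    OrderDual.toDual {p | G.wlColor i p.1.1 p.1.2 = G.wlColor i p.2.1 p.2.2}
  have hf : Monotone f := by
    refine monotone_nat_of_le_succ fun i => ?_
    intro p hp
    exact congrArg Prod.fst hp
  obtain ⟨n, hn⟩ := WellFoundedGT.monotone_chain_condition ⟨f, hf⟩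
  refine ⟨n, fun v₁ v₂ w₁ w₂ h => ?_⟩
  have h1 : f n = f (n + 1) := hn (n + 1) (Nat.le_succ n)
  have h2 : ((v₁, v₂), (w₁, w₂)) ∈ OrderDual.ofDual (f n) := h
  rw [h1] at h2
  exact h2

open Classical in
/-- The first round after which the partition of the pairs no longer changes. -/
noncomputable def wlStableRound {V : Type*} [Fintype V] (G : SimpleGraph V) : ℕ :=
  Nat.find G.exists_wlStableAt

/-- The stable colouring computed by the 2-dimensional Weisfeiler-Leman algorithm. -/
noncomputable def wlStableColor {V : Type*} [Fintype V] (G : SimpleGraph V) (v₁ v₂ : V) :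
    WLColor G.wlStableRound :=
  G.wlColor G.wlStableRound v₁ v₂

end SimpleGraph

/-! ### Association schemes -/

/-- An association scheme `(R₀, …, R_d)` on a finite set `V`; it need not be symmetric
(nor commutative). -/
structure AssociationScheme (V : Type*) [Finite V] (d : ℕ) where
  R : Fin (d + 1) → Set (V × V)
  nonempty : ∀ i, (R i).Nonempty
  /-- Every pair lies in exactly one of the relations. -/
  partition : ∀ p : V × V, ∃! i, p ∈ R i
  diagonal : R 0 = {p | p.1 = p.2}
  transpose : ∀ i, ∃ j, {p : V × V | (p.2, p.1) ∈ R i} = R j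
  intersection : ∀ i j k, ∃ m : ℕ, ∀ v w, (v, w) ∈ R k →
    {x : V | (v, x) ∈ R i ∧ (w, x) ∈ R j}.ncard = m

/-- The constituent graph `(V, Rᵢ ∪ Rᵢᵀ)`, as a simple graph (loops, which occur only for
`i = 0`, are dropped). -/
def AssociationScheme.constituentGraph {V : Type*} [Finite V] {d : ℕ}
    (A : AssociationScheme V d) (i : Fin (d + 1)) : SimpleGraph V :=
  SimpleGraph.fromRel fun v w => (v, w) ∈ A.R i

/-!
Both the stable colouring of a graph all of whose vertices receive the same colour and an
association scheme are homogeneous coherent colourings of the pairs (`IsCoherentColouring`), and in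
both cases the adjacency relation of the graph `G` in question is a union of colour classes. The real
matrices constant on the colours form an algebra that is also closed under entrywise operations, and
each of its members has constant row sums and a constant diagonal. In particular `G` is regular, say
of degree `d`. If `G` is connected with at least four vertices, then `d ≥ 2`, and `d = 2` makes it a
cycle. It remains to show that `d ≤ 2` whenever `G - {a, b}` is disconnected.

Let `θ` be the second largest eigenvalue of `G` and `P` the projection onto its eigenspace. Being a
polynomial in `A - 2J`, a multiple of `P` lies in the algebra, so after scaling its rows are unit
vectors `e v` with `∑ w ~ v, e w = θ e v` whose inner products depend on colours only
(`exists_isSpectralEmbedding`). Some component `K` of `G - {a, b}` has largest eigenvalue at most `θ`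
(`IsPairComponent.rayleighLE_or`). A minimum principle for the eigenvalue equation on `K`
(`IsPairComponent.nonneg_or_neg`) then forces the vectors `e v`, `v ∈ K`, to lie on a circular arc of
length at most `π` from `e a` to `e b` (`IsSpectralEmbedding.isArc`). The exceptional case, in which
`θ` is itself the largest eigenvalue of `K`, gives a half circle.

The multiset of angles between a vertex and its neighbours is the same for all vertices. If some
vertex of `K` lies at an end of the arc, then the balance condition puts all of `K` at two antipodal
points, and counting edges gives `d ≤ 2` (`IsArc.degree_le_two_of_endpoint`). Otherwise the vertex `v`
of `K` nearest to `a` has the single neighbour `a` on one side, at angle `α`. If `v` has no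
neighbour at angle zero and `d ≥ 3`, then `a` is strictly the farthest of its neighbours, and
comparing with the second nearest vertex of `K` gives a contradiction. If `v` has a neighbour at angle
zero, then some triangle at `v` has no counterpart at `a` (`IsArc.degree_le_two_of_interior`).
-/

/-! ### Cycles, small graphs and components of `G - {a, b}` -/

namespace SimpleGraph

variable {V : Type*}

/-- If a set of vertices of a connected graph is nonempty and closed under adjacency, it contains
every vertex. -/
theorem Connected.forall_of_adj {G : SimpleGraph V} (hG : G.Connected) {T : V → Prop} {v₀ : V}
    (h₀ : T v₀) (hT : ∀ v w, T v → G.Adj v w → T w) (v : V) : T v := by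
  obtain ⟨p⟩ := hG.preconnected v₀ v
  induction p with
  | nil => exact h₀
  | cons h _ ih => exact ih (hT _ _ h₀ h)

/-- A connected graph all of whose vertices have degree two is a cycle: it is not a tree, so it
contains a copy of a cycle, which has no further neighbours. -/
theorem Connected.exists_iso_cycleGraph [Fintype V] {G : SimpleGraph V} [DecidableRel G.Adj]
    (hG : G.Connected) (h2 : ∀ v, G.degree v = 2) :
    ∃ l, 3 ≤ l ∧ Nonempty (G ≃g cycleGraph l) := by
  classical
  have hcyc : ¬ G.IsAcyclic := by
    intro hac
    have h1 := IsTree.card_edgeFinset (G := G) ⟨hG, hac⟩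
    have h3 := G.sum_degrees_eq_twice_card_edges
    simp only [h2, Finset.sum_const, Finset.card_univ, smul_eq_mul] at h3
    have := Fintype.card_pos_iff.2 hG.nonempty
    omega
  rw [isAcyclic_iff_free_cycleGraph] at hcyc
  simp only [Free, not_forall, not_not] at hcyc
  obtain ⟨l, hl, ⟨f⟩⟩ := hcyc
  refine ⟨l, hl, ?_⟩
  obtain ⟨m, rfl⟩ : ∃ m, l = m + 3 := ⟨l - 3, by omega⟩
  have hf : Function.Injective f := f.injective
  have hnb : ∀ i, G.neighborFinset (f i) = ((cycleGraph (m + 3)).neighborFinset i).image f := by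
    intro i
    symm
    apply Finset.eq_of_subset_of_card_le
    · intro w hw
      obtain ⟨j, hj, rfl⟩ := Finset.mem_image.1 hw
      rw [mem_neighborFinset] at hj ⊢
      exact f.toHom.map_adj hj
    · rw [Finset.card_image_of_injective _ hf, card_neighborFinset_eq_degree,
        card_neighborFinset_eq_degree, h2, cycleGraph_degree_three_le]
  have hadj : ∀ i w, G.Adj (f i) w ↔ ∃ j, (cycleGraph (m + 3)).Adj i j ∧ f j = w := by
    intro i w
    rw [← mem_neighborFinset, hnb]
    simp
  have hsurj : Function.Surjective f := by
    intro v
    refine hG.forall_of_adj (T := fun v => ∃ i, f i = v) (v₀ := f 0) ⟨0, rfl⟩ ?_ v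
    rintro _ w ⟨i, rfl⟩ h
    obtain ⟨j, -, hj⟩ := (hadj i w).1 h
    exact ⟨j, hj⟩
  have hbij : Function.Bijective f := ⟨hf, hsurj⟩
  refine ⟨(RelIso.mk (Equiv.ofBijective f hbij) ?_ :
    cycleGraph (m + 3) ≃g G).symm⟩
  intro i j
  change G.Adj (f i) (f j) ↔ _
  rw [hadj]
  constructor
  · rintro ⟨k, hk, hkj⟩
    rwa [← hf hkj]
  · exact fun h => ⟨j, h, rfl⟩

theorem Connected.card_connectedComponent {G : SimpleGraph V} (hG : G.Connected) :
    Nat.card G.ConnectedComponent = 1 := by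
  have := hG.preconnected.subsingleton_connectedComponent
  have : Nonempty G.ConnectedComponent := ⟨G.connectedComponentMk hG.nonempty.some⟩
  exact Nat.card_unique

theorem Connected.isThreeConnected_of_card_le_three [Fintype V] {G : SimpleGraph V}
    (hG : G.Connected) (h3 : Fintype.card V ≤ 3) : G.IsThreeConnected := by
  classical
  refine ⟨hG, ?_⟩
  rintro ⟨S, hS, hsep⟩
  rw [IsSeparator, hG.card_connectedComponent] at hsep
  have h1 : Nat.card (G.induce ((S : Set V)ᶜ)).ConnectedComponent ≤
      Nat.card ((S : Set V)ᶜ : Set V) :=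
    Nat.card_le_card_of_surjective _ (fun c => c.exists_rep)
  have h2 : Nat.card ((S : Set V)ᶜ : Set V) = Fintype.card V - 2 := by
    rw [← hS, ← Finset.card_compl, ← Finset.coe_compl, Nat.card_eq_card_toFinset]
    simp
  omega

theorem Connected.card_le_two_of_degree_le_one [Fintype V] {G : SimpleGraph V}
    [DecidableRel G.Adj] (hG : G.Connected) (h1 : ∀ v, G.degree v ≤ 1) : Fintype.card V ≤ 2 := by
  classical
  have h2 := hG.card_vert_le_card_edgeSet_add_one
  rw [Nat.card_eq_fintype_card, Nat.card_eq_fintype_card, ← edgeFinset_card] at h2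
  have h3 := G.sum_degrees_eq_twice_card_edges
  have h4 : ∑ v, G.degree v ≤ ∑ _v : V, 1 := Finset.sum_le_sum fun v _ => h1 v
  simp at h4
  omega

/-- The two neighbours of a vertex of degree two separate it from the remaining vertices. -/
theorem not_isThreeConnected_of_degree_eq_two [Fintype V] {G : SimpleGraph V}
    [DecidableRel G.Adj] {v : V} (hv : G.degree v = 2) (h4 : 4 ≤ Fintype.card V) :
    ¬ G.IsThreeConnected := by
  classical
  rintro ⟨hG, hS⟩
  refine hS ⟨G.neighborFinset v, hv, ?_⟩
  rw [IsSeparator, hG.card_connectedComponent]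
  obtain ⟨u, hu⟩ : ∃ u, u ∉ insert v (G.neighborFinset v) := by
    by_contra! h
    have h5 : Finset.univ ⊆ insert v (G.neighborFinset v) := fun u _ => h u
    have h6 := (Finset.card_le_card h5).trans (Finset.card_insert_le _ _)
    rw [card_neighborFinset_eq_degree, hv, Finset.card_univ] at h6
    omega
  rw [Finset.mem_insert, not_or] at hu
  let v' : ((G.neighborFinset v : Set V)ᶜ : Set V) := ⟨v, by simp⟩
  let u' : ((G.neighborFinset v : Set V)ᶜ : Set V) := ⟨u, by simpa using hu.2⟩
  rw [Finite.one_lt_card_iff_nontrivial]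
  refine ⟨⟨connectedComponentMk _ v', connectedComponentMk _ u', ?_⟩⟩
  intro h
  obtain ⟨p⟩ := ConnectedComponent.exact h
  have hne : v' ≠ u' := fun h => hu.1 (congrArg Subtype.val h).symm
  obtain ⟨w, hw, -, -⟩ := p.exists_eq_cons_of_ne hne
  have hw' : G.Adj v w := hw
  exact w.2 (by simpa using hw')

/-- `K` is the vertex set of a connected component of `G - {a, b}`. Connectedness is recorded as
an induction principle. -/
structure IsPairComponent (G : SimpleGraph V) (a b : V) (K : Finset V) : Prop where
  nonempty : K.Nonempty
  left_notMem : a ∉ K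
  right_notMem : b ∉ K
  mem_of_adj : ∀ v ∈ K, ∀ w, G.Adj v w → w ∈ K ∨ w = a ∨ w = b
  forall_of_adj : ∀ T : V → Prop, (∃ v ∈ K, T v) →
    (∀ v ∈ K, T v → ∀ w ∈ K, G.Adj v w → T w) → ∀ v ∈ K, T v

/-- Every component of `G - {a, b}` is joined to `{a, b}` if `G` is connected. -/
theorem IsPairComponent.exists_adj {G : SimpleGraph V} {a b : V} {K : Finset V}
    (hK : G.IsPairComponent a b K) (hG : G.Connected) :
    ∃ v ∈ K, G.Adj v a ∨ G.Adj v b := by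
  by_contra! h
  obtain ⟨v₀, hv₀⟩ := hK.nonempty
  refine hK.left_notMem (hG.forall_of_adj (T := (· ∈ K)) hv₀ (fun v w hv hw => ?_) a)
  rcases hK.mem_of_adj v hv w hw with h1 | rfl | rfl
  · exact h1
  · exact absurd hw (h v hv).1
  · exact absurd hw (h v hv).2

open Classical in
theorem isPairComponent_supp [Fintype V] (G : SimpleGraph V) (a b : V)
    (c : (G.induce (({a, b} : Finset V) : Set V)ᶜ).ConnectedComponent) :
    G.IsPairComponent a b
      {v | ∃ h : v ∈ (({a, b} : Finset V) : Set V)ᶜ, connectedComponentMk _ ⟨v, h⟩ = c} := by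
  refine ⟨?_, ?_, ?_, ?_, ?_⟩
  · obtain ⟨⟨v, hv⟩, rfl⟩ := c.exists_rep
    exact ⟨v, by simpa using ⟨by simpa using hv, rfl⟩⟩
  · simp
  · simp
  · intro v hv w hw
    simp only [Finset.mem_filter, Finset.mem_univ, true_and] at hv ⊢
    obtain ⟨h1, rfl⟩ := hv
    by_cases h2 : w ∈ (({a, b} : Finset V) : Set V)ᶜ
    · refine Or.inl ⟨h2, ConnectedComponent.sound (Adj.reachable ?_)⟩
      exact hw.symm
    · right
      have h3 : w ∈ ({a, b} : Finset V) := by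
        by_contra h
        exact h2 h
      simpa using h3
  · rintro T ⟨v₀, hv₀, hT₀⟩ hT v hv
    simp only [Finset.mem_filter, Finset.mem_univ, true_and] at hv hv₀ hT
    obtain ⟨h1, h2⟩ := hv
    obtain ⟨h3, h4⟩ := hv₀
    obtain ⟨p⟩ := ConnectedComponent.exact (h4.trans h2.symm)
    have key : ∀ x y : ((({a, b} : Finset V) : Set V)ᶜ : Set V),
        (G.induce (({a, b} : Finset V) : Set V)ᶜ).Walk x y →
        connectedComponentMk _ x = c → T x → T y := by
      intro x y q
      induction q with
      | nil => exact fun _ h => h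
      | @cons x z y h _ ih =>
        intro hx hTx
        have hz : connectedComponentMk _ z = c := by
          rw [← hx]
          exact (ConnectedComponent.sound h.reachable).symm
        exact ih hz (hT x ⟨x.2, hx⟩ hTx z ⟨z.2, hz⟩ h)
    exact key _ _ p h4 hT₀

/-- A connected graph that is not 3-connected has two vertices `a`, `b` such that `G - {a, b}` has
two different components. -/
theorem Connected.exists_isPairComponent [Fintype V] {G : SimpleGraph V}
    (hG : G.Connected) (h3 : ¬ G.IsThreeConnected) :
    ∃ a b : V, a ≠ b ∧ ∃ K L : Finset V, G.IsPairComponent a b K ∧ G.IsPairComponent a b L ∧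
      Disjoint K L := by
  classical
  have hS : ∃ S : Finset V, S.card = 2 ∧ G.IsSeparator S := by
    by_contra h
    exact h3 ⟨hG, h⟩
  obtain ⟨S, hS, hsep⟩ := hS
  obtain ⟨a, b, hab, rfl⟩ := Finset.card_eq_two.1 hS
  rw [IsSeparator, hG.card_connectedComponent, Finite.one_lt_card_iff_nontrivial] at hsep
  obtain ⟨c, c', hc⟩ := hsep
  refine ⟨a, b, hab, _, _, isPairComponent_supp G a b c, isPairComponent_supp G a b c', ?_⟩
  rw [Finset.disjoint_left]
  intro v hv hv'
  simp only [Finset.mem_filter, Finset.mem_univ, true_and] at hv hv'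
  obtain ⟨h1, h2⟩ := hv
  obtain ⟨h1', h2'⟩ := hv'
  exact hc (h2.symm.trans h2')

end SimpleGraph

/-! ### Homogeneous coherent colourings -/

/-- A homogeneous coherent colouring of the pairs over a finite set: the colour of a pair tells
whether it is diagonal, all diagonal pairs have the same colour, and the colour of `(v, w)`
determines how many `x` make `(v, x)` and `(x, w)` have prescribed colours. Both the stable
colouring of a graph with a single vertex colour and an association scheme give rise to such
colourings; closure under transposition is not needed. -/
structure IsCoherentColouring {V κ : Type*} [Fintype V] (c : V → V → κ) : Prop where
  eq_iff : ∀ v w v' w', c v w = c v' w' → (v = w ↔ v' = w')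
  diag : ∀ v w, c v v = c w w
  triangle : ∀ v w v' w', c v w = c v' w' →
    (Finset.univ : Finset V).val.map (fun x => (c v x, c x w)) =
      (Finset.univ : Finset V).val.map (fun x => (c v' x, c x w'))

/-- `M v w` depends on the colour of `(v, w)` only. For real-valued `M` these are the elements of
the adjacency algebra of the colouring. -/
def IsColourConstant {V κ α : Type*} (c : V → V → κ) (M : V → V → α) : Prop :=
  ∀ v w v' w', c v w = c v' w' → M v w = M v' w'

namespace IsColourConstant

variable {V κ α β γ : Type*} {c : V → V → κ}

theorem exists_factor [Nonempty α] {M : V → V → α} (hM : IsColourConstant c M) :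
    ∃ g : κ → α, ∀ v w, M v w = g (c v w) := by
  classical
  refine ⟨fun k => if h : ∃ p : V × V, c p.1 p.2 = k then M h.choose.1 h.choose.2
    else Classical.arbitrary α, fun v w => ?_⟩
  have h : ∃ p : V × V, c p.1 p.2 = c v w := ⟨(v, w), rfl⟩
  simp only [dif_pos h]
  exact hM _ _ _ _ h.choose_spec.symm

theorem comp {M : V → V → α} (hM : IsColourConstant c M) (f : α → β) :
    IsColourConstant c fun v w => f (M v w) :=
  fun v w v' w' h => congrArg f (hM v w v' w' h)

theorem comp₂ {M : V → V → α} {N : V → V → β} (hM : IsColourConstant c M)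
    (hN : IsColourConstant c N) (f : α → β → γ) :
    IsColourConstant c fun v w => f (M v w) (N v w) :=
  fun v w v' w' h => congrArg₂ f (hM v w v' w' h) (hN v w v' w' h)

variable [Fintype V]

theorem diag_eq (hc : IsCoherentColouring c) {M : V → V → α} (hM : IsColourConstant c M)
    (v w : V) : M v v = M w w :=
  hM _ _ _ _ (hc.diag v w)

theorem sum_mul (hc : IsCoherentColouring c) {M N : V → V → ℝ} (hM : IsColourConstant c M)
    (hN : IsColourConstant c N) : IsColourConstant c fun v w => ∑ x, M v x * N x w := by
  intro v w v' w' h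
  obtain ⟨g, hg⟩ := hM.exists_factor
  obtain ⟨g', hg'⟩ := hN.exists_factor
  have := congrArg (fun s => (s.map fun p => g p.1 * g' p.2).sum) (hc.triangle v w v' w' h)
  simp only [Multiset.map_map, Function.comp_def] at this
  simp only [hg, hg']
  exact this

theorem sum_row_eq (hc : IsCoherentColouring c) {M : V → V → ℝ} (hM : IsColourConstant c M)
    (v v' : V) : ∑ w, M v w = ∑ w, M v' w := by
  have h1 : IsColourConstant c fun _ _ : V => (1 : ℝ) := fun _ _ _ _ _ => rfl
  simpa using sum_mul hc hM h1 v v v' v' (hc.diag v v')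

open Classical in
theorem card_filter_eq (hc : IsCoherentColouring c) {P : V → V → Prop}
    (hP : IsColourConstant c P) (v v' : V) :
    (Finset.univ.filter (P v)).card = (Finset.univ.filter (P v')).card := by
  have := sum_row_eq hc (hP.comp fun p => if p then (1 : ℝ) else 0) v v'
  simpa using this

open Classical in
/-- Relational composition preserves constancy on colours. -/
theorem exists_and (hc : IsCoherentColouring c) {P Q : V → V → Prop}
    (hP : IsColourConstant c P) (hQ : IsColourConstant c Q) :
    IsColourConstant c fun v w => ∃ x, P v x ∧ Q x w := by
  have h := (sum_mul hc (hP.comp fun p => if p then (1 : ℝ) else 0)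
    (hQ.comp fun p => if p then (1 : ℝ) else 0)).comp fun r => 0 < r
  convert h using 3 with v w
  rw [Finset.sum_pos_iff_of_nonneg (fun x _ => by positivity)]
  simp only [Finset.mem_univ, true_and]
  refine exists_congr fun x => ?_
  by_cases h1 : P v x <;> by_cases h2 : Q x w <;> simp [h1, h2]

/-- The adjacency algebra contains every polynomial in each of its members. -/
theorem aeval [DecidableEq V] (hc : IsCoherentColouring c) {B : Matrix V V ℝ}
    (hB : IsColourConstant c B) (p : Polynomial ℝ) :
    IsColourConstant c (Polynomial.aeval B p) := by
  induction p using Polynomial.induction_on' with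
  | add p q hp hq =>
    rw [map_add]
    exact hp.comp₂ hq (· + ·)
  | monomial n r =>
    rw [Polynomial.aeval_monomial, Algebra.algebraMap_eq_smul_one, smul_one_mul]
    refine comp (M := B ^ n) ?_ (r * ·)
    induction n with
    | zero =>
      intro v w v' w' h
      simp [Matrix.one_apply, hc.eq_iff v w v' w' h]
    | succ n ih =>
      rw [pow_succ]
      exact sum_mul hc ih hB

end IsColourConstant

namespace SimpleGraph

variable {V : Type*} [Fintype V]

theorem wlColor_zero_eq_of_eq (G : SimpleGraph V) {i : ℕ} {v w v' w' : V}
    (h : G.wlColor i v w = G.wlColor i v' w') : G.wlColor 0 v w = G.wlColor 0 v' w' := by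
  induction i with
  | zero => exact h
  | succ i ih => exact ih (congrArg Prod.fst h)

theorem isColourConstant_adj_wlStableColor (G : SimpleGraph V) :
    IsColourConstant G.wlStableColor G.Adj :=
  fun _ _ _ _ h => congrArg Prod.snd (G.wlColor_zero_eq_of_eq h)

theorem isCoherentColouring_wlStableColor (G : SimpleGraph V)
    (h : ∀ u v : V, G.wlStableColor u u = G.wlStableColor v v) :
    IsCoherentColouring G.wlStableColor where
  eq_iff _ _ _ _ h := iff_of_eq (congrArg Prod.fst (G.wlColor_zero_eq_of_eq h))
  diag := h
  triangle v w v' w' h := by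
    classical
    have hstable : G.WLStableAt G.wlStableRound := Nat.find_spec G.exists_wlStableAt
    have h1 := congrArg (fun s => Multiset.map Prod.swap (Prod.snd s)) (hstable v w v' w' h)
    simp only [wlColor, Multiset.map_map, Function.comp_def, Prod.swap_prod_mk] at h1
    exact h1

end SimpleGraph

namespace AssociationScheme

variable {V : Type*} [Fintype V] {d : ℕ}

/-- The index of the relation containing a pair. -/
noncomputable def index (A : AssociationScheme V d) (v w : V) : Fin (d + 1) :=
  (A.partition (v, w)).choose

theorem index_eq_iff (A : AssociationScheme V d) {v w : V} {i : Fin (d + 1)} :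
    A.index v w = i ↔ (v, w) ∈ A.R i := by
  have h := (A.partition (v, w)).choose_spec
  exact ⟨fun hi => hi ▸ h.1, fun hi => (h.2 i hi).symm⟩

theorem isCoherentColouring_index (A : AssociationScheme V d) :
    IsCoherentColouring A.index where
  eq_iff v w v' w' h := by
    have h0 : ∀ x y, A.index x y = 0 ↔ x = y := fun x y => by
      rw [index_eq_iff, A.diagonal]
      rfl
    rw [← h0, ← h0, h]
  diag v w := by
    have h0 : ∀ x, A.index x x = 0 := fun x => by
      rw [index_eq_iff, A.diagonal]
      rfl
    rw [h0, h0]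
  triangle v w v' w' h := by
    classical
    ext ⟨i, j⟩
    obtain ⟨j', hj'⟩ := A.transpose j
    obtain ⟨m, hm⟩ := A.intersection i j' (A.index v w)
    have key : ∀ x y, A.index x y = A.index v w →
        ((Finset.univ : Finset V).val.map fun z => (A.index x z, A.index z y)).count (i, j)
          = m := by
      intro x y hxy
      rw [← hm x y (index_eq_iff A |>.1 hxy), Multiset.count_map, Set.ncard_eq_toFinset_card']
      change (Finset.univ.filter _).card = _
      congr 1
      ext z
      have : (y, z) ∈ A.R j' ↔ A.index z y = j := by
        rw [← hj', index_eq_iff]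
        rfl
      simp only [Finset.mem_filter, Finset.mem_univ, true_and, Set.mem_ofPred_eq, Prod.mk.injEq,
        Set.mem_toFinset, this, ← A.index_eq_iff (v := x)]
      exact and_congr eq_comm eq_comm
    rw [key v w rfl, key v' w' h.symm]

theorem isColourConstant_constituentGraph_adj (A : AssociationScheme V d) (i : Fin (d + 1)) :
    IsColourConstant A.index (A.constituentGraph i).Adj := by
  intro v w v' w' h
  obtain ⟨j, hj⟩ := A.transpose i
  have key : ∀ x y, (A.constituentGraph i).Adj x y ↔
      x ≠ y ∧ (A.index x y = i ∨ A.index x y = j) := fun x y => by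
    rw [constituentGraph, SimpleGraph.fromRel_adj, index_eq_iff, index_eq_iff, ← hj]
    rfl
  rw [key, key, h, Ne, Ne, A.isCoherentColouring_index.eq_iff v w v' w' h]

end AssociationScheme

/-! ### The second largest eigenvalue -/

/-- A symmetric real matrix has a largest eigenvalue, which bounds its quadratic form. -/
theorem Matrix.IsSymm.exists_max_eigenvalue {V : Type*} [Fintype V] [DecidableEq V] [Nonempty V]
    {B : Matrix V V ℝ} (hB : B.IsSymm) :
    ∃ θ : ℝ, Module.End.HasEigenvalue (Matrix.toLin' B) θ ∧
      ∀ f : V → ℝ, ∑ v, f v * ∑ w, B v w * f w ≤ θ * ∑ v, f v ^ 2 := by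
  have hT : (Matrix.toEuclideanLin B).IsSymmetric := by
    rw [Matrix.isSymmetric_toEuclideanLin_iff, Matrix.IsHermitian, Matrix.conjTranspose,
      hB.eq]
    ext i j
    simp
  set T := Matrix.toEuclideanLin B
  set θ : ℝ := ⨆ x : {x : EuclideanSpace ℝ V // x ≠ 0},
    RCLike.re (inner ℝ (T ↑x) ↑x) / ‖(x : EuclideanSpace ℝ V)‖ ^ 2 with hθ
  have hev := hT.hasEigenvalue_iSup_of_finiteDimensional
  rw [← hθ] at hev
  have hTapp : ∀ x : EuclideanSpace ℝ V, T x = WithLp.toLp 2 (B.mulVec x.ofLp) :=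
    fun x => Matrix.toLpLin_apply _ _ _ _
  refine ⟨θ, ?_, fun f => ?_⟩
  · obtain ⟨x, hx⟩ := hev.exists_hasEigenvector
    refine Module.End.hasEigenvalue_of_hasEigenvector (x := x.ofLp) ⟨?_, ?_⟩
    · rw [Module.End.mem_eigenspace_iff]
      have h1 := hx.apply_eq_smul
      rw [hTapp] at h1
      simpa using congrArg WithLp.ofLp h1
    · intro h
      exact hx.2 (by ext i; simpa using congrFun h i)
  · by_cases hf : f = 0
    · simp [hf]
    have hbdd : BddAbove (Set.range fun x : {x : EuclideanSpace ℝ V // x ≠ 0} =>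
        RCLike.re (inner ℝ (T ↑x) ↑x) / ‖(x : EuclideanSpace ℝ V)‖ ^ 2) := by
      refine ⟨‖LinearMap.toContinuousLinearMap T‖, ?_⟩
      rintro _ ⟨⟨x, hx⟩, rfl⟩
      have hx' : 0 < ‖x‖ := norm_pos_iff.2 hx
      rw [div_le_iff₀ (by positivity)]
      have h1 := real_inner_le_norm (T x) x
      have h2 := (LinearMap.toContinuousLinearMap T).le_opNorm x
      have h3 : RCLike.re (inner ℝ (T x) x) = inner ℝ (T x) x := rfl
      rw [LinearMap.coe_toContinuousLinearMap'] at h2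
      dsimp only
      nlinarith [norm_nonneg x]
    have hf' : (WithLp.toLp 2 f : EuclideanSpace ℝ V) ≠ 0 := by
      intro h
      exact hf (by simpa using congrArg WithLp.ofLp h)
    have h1 := le_ciSup hbdd ⟨_, hf'⟩
    rw [← hθ] at h1
    have hpos : 0 < ‖(WithLp.toLp 2 f : EuclideanSpace ℝ V)‖ := norm_pos_iff.2 hf'
    rw [div_le_iff₀ (by positivity), EuclideanSpace.norm_sq_eq, hTapp] at h1
    simpa [PiLp.inner_apply, Matrix.mulVec, dotProduct] using h1

/-- A real eigenvalue `θ` of `B` has a nonzero eigenmatrix that is a polynomial in `B`: the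
cofactor of `X - θ` in the minimal polynomial, evaluated at `B`. -/
theorem Matrix.exists_aeval_ne_zero_of_hasEigenvalue {V : Type*} [Fintype V] [DecidableEq V]
    {B : Matrix V V ℝ} {θ : ℝ} (h : Module.End.HasEigenvalue (Matrix.toLin' B) θ) :
    ∃ q : Polynomial ℝ, Polynomial.aeval B q ≠ 0 ∧
      B * Polynomial.aeval B q = θ • Polynomial.aeval B q := by
  have hroot := Module.End.isRoot_of_hasEigenvalue h
  rw [Matrix.minpoly_toLin'] at hroot
  obtain ⟨q, hq⟩ := Polynomial.dvd_iff_isRoot.2 hroot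
  have hm : minpoly ℝ B ≠ 0 := minpoly.ne_zero (Matrix.isIntegral B)
  have hq0 : q ≠ 0 := by
    rintro rfl
    exact hm (by rw [hq, mul_zero])
  refine ⟨q, fun h0 => ?_, ?_⟩
  · have h1 := Polynomial.degree_le_of_dvd (minpoly.dvd ℝ B h0) hq0
    rw [hq, Polynomial.degree_mul, Polynomial.degree_X_sub_C,
      Polynomial.degree_eq_natDegree hq0] at h1
    norm_cast at h1
    omega
  · have h1 := minpoly.aeval ℝ B
    rw [hq, map_mul, map_sub, Polynomial.aeval_X, Polynomial.aeval_C, sub_mul, sub_eq_zero,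
      Algebra.algebraMap_eq_smul_one, smul_mul_assoc, one_mul] at h1
    exact h1

theorem Matrix.IsSymm.aeval {V : Type*} [Fintype V] [DecidableEq V] {B : Matrix V V ℝ}
    (hB : B.IsSymm) (q : Polynomial ℝ) : (Polynomial.aeval B q).IsSymm := by
  induction q using Polynomial.induction_on' with
  | add p q hp hq =>
    rw [map_add]
    exact hp.add hq
  | monomial n r =>
    rw [Polynomial.aeval_monomial, Algebra.algebraMap_eq_smul_one, smul_one_mul]
    exact (hB.pow n).smul r

namespace SimpleGraph

/-- The rows of a multiple of the orthogonal projection onto the eigenspace of the second largest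
eigenvalue `θ` of `G`, abstractly: unit vectors `e v` such that every linear functional
turns `e` into an eigenvector that is orthogonal to the constant functions. The last field says that
`θ` bounds the Rayleigh quotient on the orthogonal complement of the constants. -/
structure IsSpectralEmbedding {V H : Type*} [Fintype V] [NormedAddCommGroup H]
    [InnerProductSpace ℝ H] (G : SimpleGraph V) [DecidableRel G.Adj] (θ : ℝ) (e : V → H) :
    Prop where
  norm_eq : ∀ v, ‖e v‖ = 1
  sum_neighbor : ∀ v, ∑ w ∈ G.neighborFinset v, e w = θ • e v
  sum_eq_zero : ∑ v, e v = 0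
  rayleigh : ∀ f : V → ℝ, ∑ v, f v = 0 →
    ∑ v, f v * ∑ w ∈ G.neighborFinset v, f w ≤ θ * ∑ v, f v ^ 2

theorem sum_sum_neighborFinset {V : Type*} [Fintype V] {G : SimpleGraph V} [DecidableRel G.Adj]
    {d : ℕ} (hd : ∀ v, G.degree v = d) (f : V → ℝ) :
    ∑ v, ∑ w ∈ G.neighborFinset v, f w = d * ∑ v, f v := by
  rw [Finset.sum_comm' (t' := Finset.univ) (s' := fun w => G.neighborFinset w)
    (by intro x y; simp [G.adj_comm]), Finset.mul_sum]
  refine Finset.sum_congr rfl fun v _ => ?_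
  rw [Finset.sum_const, card_neighborFinset_eq_degree, hd, nsmul_eq_mul]

/-- A regular graph whose adjacency relation is constant on the colours of a homogeneous coherent
colouring has a spectral embedding whose Gram matrix is constant on the colours. The matrix
`A - 2J` moves the trivial eigenvalue below the others, so that the second eigenvalue of `A` becomes
the largest one. -/
theorem exists_isSpectralEmbedding {V κ : Type*} [Fintype V] {G : SimpleGraph V}
    [DecidableRel G.Adj] {c : V → V → κ} (hc : IsCoherentColouring c)
    (hadj : IsColourConstant c G.Adj) {d : ℕ} (hd : ∀ v, G.degree v = d)
    (hV : 2 ≤ Fintype.card V) :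
    ∃ (θ : ℝ) (e : V → EuclideanSpace ℝ V), G.IsSpectralEmbedding θ e ∧
      IsColourConstant c fun v w => inner ℝ (e v) (e w) := by
  classical
  have : Nonempty V := Fintype.card_pos_iff.1 (by omega)
  let B : Matrix V V ℝ := fun v w => (if G.Adj v w then 1 else 0) - 2
  have hBsymm : B.IsSymm := by
    refine Matrix.IsSymm.ext fun v w => ?_
    simp [B, G.adj_comm]
  have hBcc : IsColourConstant c B := by
    intro v w v' w' h
    simp [B, hadj v w v' w' h]
  have hBsum : ∀ v (f : V → ℝ),
      ∑ w, B v w * f w = ∑ w ∈ G.neighborFinset v, f w - 2 * ∑ w, f w := by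
    intro v f
    simp only [B, sub_mul, Finset.sum_sub_distrib, Finset.mul_sum, ite_mul, one_mul, zero_mul]
    rw [← Finset.sum_filter, neighborFinset_eq_filter]
  obtain ⟨θ, hθ, hray⟩ := hBsymm.exists_max_eigenvalue
  obtain ⟨q, hP0, hBP⟩ := Matrix.exists_aeval_ne_zero_of_hasEigenvalue hθ
  set P := Polynomial.aeval B q with hP
  have hPsymm : P.IsSymm := hBsymm.aeval q
  have hPcc : IsColourConstant c P := IsColourConstant.aeval hc hBcc q
  have hθ2 : -2 ≤ θ := by
    have u : V := Classical.arbitrary V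
    have h1 := hray (Pi.single u 1)
    simpa [Pi.single_apply, ite_pow, B] using h1
  have hdn : d < Fintype.card V := by
    rw [← hd (Classical.arbitrary V)]
    exact G.degree_lt_card_verts _
  have hBP' : ∀ v i, ∑ w ∈ G.neighborFinset v, P w i - 2 * ∑ w, P w i = θ * P v i := by
    intro v i
    rw [← hBsum v fun w => P w i]
    exact congrFun (congrFun hBP v) i
  have hcol : ∀ i, ∑ w, P w i = 0 := by
    intro i
    have h1 : ∑ v, (∑ w ∈ G.neighborFinset v, P w i - 2 * ∑ w, P w i) = ∑ v, θ * P v i :=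
      Finset.sum_congr rfl fun v _ => hBP' v i
    rw [Finset.sum_sub_distrib, sum_sum_neighborFinset hd fun w => P w i, Finset.sum_const,
      ← Finset.mul_sum, Finset.card_univ, nsmul_eq_mul] at h1
    have h2 : ((d : ℝ) - 2 * Fintype.card V - θ) * ∑ w, P w i = 0 := by linarith
    refine (mul_eq_zero.1 h2).resolve_left ?_
    have h3 : (d : ℝ) < Fintype.card V := by exact_mod_cast hdn
    have h4 : (2 : ℝ) ≤ Fintype.card V := by exact_mod_cast hV
    linarith
  have hEcc : IsColourConstant c fun v w => ∑ i, P v i * P i w :=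
    IsColourConstant.sum_mul hc hPcc hPcc
  have hE : ∀ v w, ∑ i, P v i * P i w = ∑ i, P v i * P w i := fun v w =>
    Finset.sum_congr rfl fun i _ => by rw [hPsymm.apply w i]
  obtain ⟨k, hk⟩ : ∃ k, ∀ v, ∑ i, P v i ^ 2 = k := by
    refine ⟨∑ i, P (Classical.arbitrary V) i ^ 2, fun v => ?_⟩
    have := hEcc.diag_eq hc v (Classical.arbitrary V)
    simpa only [hE, ← pow_two] using this
  have hkpos : 0 < k := by
    obtain ⟨v, i, hvi⟩ : ∃ v i, P v i ≠ 0 := by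
      by_contra! h
      exact hP0 (by ext v i; exact h v i)
    rw [← hk v]
    exact lt_of_lt_of_le (by positivity)
      (Finset.single_le_sum (f := fun i => P v i ^ 2) (fun _ _ => by positivity)
        (Finset.mem_univ i))
  refine ⟨θ, fun v => (√k)⁻¹ • WithLp.toLp 2 (P v), ⟨fun v => ?_, fun v => ?_, ?_, ?_⟩, ?_⟩
  · rw [norm_smul, EuclideanSpace.norm_eq]
    simp only [Real.norm_eq_abs, sq_abs, hk]
    rw [abs_of_pos (by positivity)]
    have := Real.sqrt_pos.2 hkpos
    field_simp
  · ext i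
    have := hBP' v i
    rw [hcol, mul_zero, sub_zero] at this
    simp only [PiLp.smul_apply, WithLp.ofLp_sum, Finset.sum_apply, smul_eq_mul]
    rw [← Finset.mul_sum, this]
    ring
  · ext i
    simp only [PiLp.smul_apply, WithLp.ofLp_sum, Finset.sum_apply, smul_eq_mul]
    rw [← Finset.mul_sum, hcol, mul_zero]
    rfl
  · intro f hf
    have := hray f
    simpa only [hBsum, hf, mul_zero, sub_zero] using this
  · have := hEcc.comp fun r => k⁻¹ * r
    convert this using 3 with v w
    rw [real_inner_smul_left, real_inner_smul_right, PiLp.inner_apply, hE, ← mul_assoc,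
      ← mul_inv, Real.mul_self_sqrt hkpos.le]
    simp [mul_comm]

end SimpleGraph

/-! ### Eigenvectors on a component of `G - {a, b}` -/

namespace SimpleGraph

variable {V : Type*} [Fintype V] {G : SimpleGraph V} [DecidableRel G.Adj]

theorem sum_mul_sum_neighborFinset_comm (f g : V → ℝ) :
    ∑ v, f v * ∑ w ∈ G.neighborFinset v, g w = ∑ v, g v * ∑ w ∈ G.neighborFinset v, f w := by
  simp only [Finset.mul_sum]
  rw [Finset.sum_comm' (t' := Finset.univ) (s' := fun w => G.neighborFinset w)
    (by intro x y; simp [G.adj_comm])]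
  exact Finset.sum_congr rfl fun v _ => Finset.sum_congr rfl fun w _ => mul_comm _ _

/-- The largest eigenvalue of the subgraph induced on `K` is at most `θ`. -/
def RayleighLE (G : SimpleGraph V) [DecidableRel G.Adj] (K : Finset V) (θ : ℝ) : Prop :=
  ∀ f : V → ℝ, (∀ v, v ∉ K → f v = 0) →
    ∑ v, f v * ∑ w ∈ G.neighborFinset v, f w ≤ θ * ∑ v, f v ^ 2

/-- Of two components, one has largest eigenvalue at most `θ`: otherwise some combination
of two functions supported on them is orthogonal to the constants and violates the Rayleigh bound. -/
theorem IsPairComponent.rayleighLE_or {a b : V} {K L : Finset V} (hK : G.IsPairComponent a b K)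
    (hL : G.IsPairComponent a b L) (hKL : Disjoint K L) {θ : ℝ}
    (hθ : ∀ f : V → ℝ, ∑ v, f v = 0 →
      ∑ v, f v * ∑ w ∈ G.neighborFinset v, f w ≤ θ * ∑ v, f v ^ 2) :
    G.RayleighLE K θ ∨ G.RayleighLE L θ := by
  by_contra! h
  simp only [RayleighLE, not_forall, not_le] at h
  obtain ⟨⟨f, hf, hf1⟩, g, hg, hg1⟩ := h
  have hfg : ∑ v, f v * ∑ w ∈ G.neighborFinset v, g w = 0 := by
    refine Finset.sum_eq_zero fun v _ => ?_
    by_cases hv : v ∈ K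
    · rw [Finset.sum_eq_zero, mul_zero]
      intro w hw
      refine hg w fun hwL => ?_
      rcases hK.mem_of_adj v hv w ((mem_neighborFinset _ _ _).1 hw) with h | rfl | rfl
      · exact Finset.disjoint_left.1 hKL h hwL
      · exact hL.left_notMem hwL
      · exact hL.right_notMem hwL
    · rw [hf v hv, zero_mul]
  have hgf := hfg
  rw [sum_mul_sum_neighborFinset_comm] at hgf
  have hfg2 : ∑ v, f v * g v = 0 := by
    refine Finset.sum_eq_zero fun v _ => ?_
    by_cases hv : v ∈ K
    · rw [hg v (Finset.disjoint_left.1 hKL hv), mul_zero]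
    · rw [hf v hv, zero_mul]
  set s := ∑ v, g v with hs
  set t := ∑ v, f v with ht
  by_cases ht0 : t = 0
  · exact absurd (hθ f ht0) (not_le.2 hf1)
  have h1 := hθ (fun v => s * f v - t * g v) (by
    rw [Finset.sum_sub_distrib, ← Finset.mul_sum, ← Finset.mul_sum, ← hs, ← ht]
    ring)
  have h2 : ∑ v, (s * f v - t * g v) * ∑ w ∈ G.neighborFinset v, (s * f w - t * g w) =
      s ^ 2 * ∑ v, f v * ∑ w ∈ G.neighborFinset v, f w
      - s * t * ∑ v, f v * ∑ w ∈ G.neighborFinset v, g w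
      - s * t * ∑ v, g v * ∑ w ∈ G.neighborFinset v, f w
      + t ^ 2 * ∑ v, g v * ∑ w ∈ G.neighborFinset v, g w := by
    simp only [Finset.sum_sub_distrib, ← Finset.mul_sum]
    simp only [Finset.mul_sum (s := Finset.univ), ← Finset.sum_sub_distrib,
      ← Finset.sum_add_distrib]
    exact Finset.sum_congr rfl fun v _ => by ring
  have h3 : ∑ v, (s * f v - t * g v) ^ 2 =
      s ^ 2 * ∑ v, f v ^ 2 - 2 * (s * t) * ∑ v, f v * g v + t ^ 2 * ∑ v, g v ^ 2 := by
    simp only [Finset.mul_sum, ← Finset.sum_sub_distrib, ← Finset.sum_add_distrib]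
    exact Finset.sum_congr rfl fun v _ => by ring
  rw [h2, h3, hfg, hgf, hfg2] at h1
  have h4 : 0 < t ^ 2 := by positivity
  nlinarith [sq_nonneg s, mul_pos h4 (sub_pos.2 hg1),
    mul_nonneg (sq_nonneg s) (sub_pos.2 hf1).le]

/-- A maximiser of the Rayleigh quotient on `K` is an eigenvector of the induced subgraph. -/
theorem RayleighLE.sum_neighborFinset_eq {K : Finset V} {θ : ℝ} (hK : G.RayleighLE K θ)
    {f : V → ℝ} (hf : ∀ v, v ∉ K → f v = 0)
    (hmax : θ * ∑ v, f v ^ 2 ≤ ∑ v, f v * ∑ w ∈ G.neighborFinset v, f w) {u : V} (hu : u ∈ K) :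
    ∑ w ∈ G.neighborFinset u, f w = θ * f u := by
  classical
  set m := ∑ w ∈ G.neighborFinset u, f w - θ * f u with hm
  have key : ∀ ε : ℝ, 2 * ε * m ≤ θ * ε ^ 2 := by
    intro ε
    let δ : V → ℝ := Pi.single u 1
    have hδ : ∀ v, v ≠ u → δ v = 0 := fun v hv => Pi.single_eq_of_ne hv _
    have hδu : δ u = 1 := Pi.single_eq_same _ _
    have hδsum : ∀ g : V → ℝ, ∑ v, δ v * g v = g u := by
      intro g
      rw [Finset.sum_eq_single u (fun v _ hv => by rw [hδ v hv, zero_mul]) (by simp), hδu,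
        one_mul]
    have h1 := hK (fun v => f v + ε * δ v) (by
      intro v hv
      rw [hf v hv, hδ v (by rintro rfl; exact hv hu)]
      ring)
    have hδδ : ∑ v, δ v * ∑ w ∈ G.neighborFinset v, δ w = 0 := by
      rw [hδsum]
      exact Finset.sum_eq_zero fun w hw => hδ w ((mem_neighborFinset _ _ _).1 hw).ne'
    have hfδ : ∑ v, f v * ∑ w ∈ G.neighborFinset v, δ w = ∑ w ∈ G.neighborFinset u, f w := by
      rw [sum_mul_sum_neighborFinset_comm, hδsum]
    have h2 : ∑ v, (f v + ε * δ v) * ∑ w ∈ G.neighborFinset v, (f w + ε * δ w) =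
        ∑ v, f v * ∑ w ∈ G.neighborFinset v, f w
        + ε * ∑ v, f v * ∑ w ∈ G.neighborFinset v, δ w
        + ε * ∑ v, δ v * ∑ w ∈ G.neighborFinset v, f w
        + ε ^ 2 * ∑ v, δ v * ∑ w ∈ G.neighborFinset v, δ w := by
      simp only [Finset.sum_add_distrib, ← Finset.mul_sum]
      simp only [Finset.mul_sum (s := Finset.univ), ← Finset.sum_add_distrib]
      exact Finset.sum_congr rfl fun v _ => by ring
    have h3 : ∑ v, (f v + ε * δ v) ^ 2 =
        ∑ v, f v ^ 2 + 2 * ε * ∑ v, δ v * f v + ε ^ 2 * ∑ v, δ v * δ v := by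
      simp only [Finset.mul_sum, ← Finset.sum_add_distrib]
      exact Finset.sum_congr rfl fun v _ => by ring
    rw [h2, h3, hδδ, hfδ, hδsum, hδsum, hδsum, hδu] at h1
    rw [hm]
    nlinarith
  -- `ε` proportional to `m` makes the first-order term dominate.
  have h1 := key (m / (|θ| + 1))
  have hpos : 0 < |θ| + 1 := by positivity
  have h2 : 2 * (m / (|θ| + 1)) * m = 2 * m ^ 2 * (|θ| + 1) / (|θ| + 1) ^ 2 := by
    field_simp
  rw [h2, div_pow, ← mul_div_assoc, div_le_div_iff_of_pos_right (by positivity)] at h1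
  have h3 : m ^ 2 = 0 := by
    nlinarith [le_abs_self θ, sq_nonneg m, abs_nonneg θ]
  have h4 : m = 0 := by simpa using h3
  linarith

/-- Minimum principle: a solution of the eigenvalue equation on `K` that is nonnegative at `a` and
`b` is nonnegative on `K`, unless its restriction to `K` is a negative eigenvector of the subgraph
induced on `K`. -/
theorem IsPairComponent.nonneg_or_neg {a b : V} {K : Finset V} (hK : G.IsPairComponent a b K)
    {θ : ℝ} (hray : G.RayleighLE K θ) {z : V → ℝ}
    (hz : ∀ v ∈ K, ∑ w ∈ G.neighborFinset v, z w = θ * z v) (ha : 0 ≤ z a) (hb : 0 ≤ z b) :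
    (∀ v ∈ K, 0 ≤ z v) ∨ ((∀ v ∈ K, z v < 0) ∧
      ∀ v ∈ K, (G.Adj v a → z a = 0) ∧ (G.Adj v b → z b = 0)) := by
  classical
  by_cases hneg : ∀ v ∈ K, 0 ≤ z v
  · exact Or.inl hneg
  right
  push Not at hneg
  let f : V → ℝ := fun v => if v ∈ K then max (-z v) 0 else 0
  have hfK : ∀ v ∈ K, f v = max (-z v) 0 := fun v hv => if_pos hv
  have hf0 : ∀ v, v ∉ K → f v = 0 := fun v hv => if_neg hv
  have hfnn : ∀ v, 0 ≤ f v := fun v => by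
    by_cases hv : v ∈ K
    · rw [hfK v hv]; exact le_max_right _ _
    · rw [hf0 v hv]
  have hfneg : ∀ v ∈ K, z v < 0 → f v = -z v := fun v hv h => by
    rw [hfK v hv, max_eq_left (by linarith)]
  have hfa : f a = 0 := hf0 a hK.left_notMem
  have hfb : f b = 0 := hf0 b hK.right_notMem
  have hzf : ∀ v ∈ K, ∀ w ∈ G.neighborFinset v, 0 ≤ z w + f w := by
    intro v hv w hw
    rcases hK.mem_of_adj v hv w ((mem_neighborFinset _ _ _).1 hw) with h | rfl | rfl
    · rw [hfK w h]
      linarith [le_max_left (-z w) 0]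
    · rwa [hfa, add_zero]
    · rwa [hfb, add_zero]
  have hfz : ∀ v, f v * z v = - f v ^ 2 := by
    intro v
    by_cases hv : v ∈ K
    · rw [hfK v hv]
      rcases le_total (-z v) 0 with h | h
      · rw [max_eq_right h]; ring
      · rw [max_eq_left h]; ring
    · rw [hf0 v hv]; ring
  have hterm : ∀ v, 0 ≤ f v * ∑ w ∈ G.neighborFinset v, (z w + f w) := by
    intro v
    by_cases hv : v ∈ K
    · exact mul_nonneg (hfnn v) (Finset.sum_nonneg (hzf v hv))
    · rw [hf0 v hv, zero_mul]
  have hsum : ∑ v, f v * ∑ w ∈ G.neighborFinset v, (z w + f w) =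
      ∑ v, f v * ∑ w ∈ G.neighborFinset v, f w - θ * ∑ v, f v ^ 2 := by
    rw [Finset.mul_sum, ← Finset.sum_sub_distrib]
    refine Finset.sum_congr rfl fun v _ => ?_
    rw [Finset.sum_add_distrib]
    by_cases hv : v ∈ K
    · rw [hz v hv]
      linear_combination θ * hfz v
    · rw [hf0 v hv]; ring
  have hle := hray f hf0
  have hsum0 : ∑ v, f v * ∑ w ∈ G.neighborFinset v, (z w + f w) = 0 :=
    le_antisymm (by rw [hsum]; linarith) (Finset.sum_nonneg fun v _ => hterm v)
  have hterm0 : ∀ v, f v * ∑ w ∈ G.neighborFinset v, (z w + f w) = 0 := fun v =>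
    (Finset.sum_eq_zero_iff_of_nonneg fun v _ => hterm v).1 hsum0 v (Finset.mem_univ v)
  have hnb : ∀ v ∈ K, z v < 0 → ∀ w, G.Adj v w → z w + f w = 0 := by
    intro v hv hzv w hw
    have h1 : f v ≠ 0 := by
      rw [hfneg v hv hzv]
      linarith
    exact (Finset.sum_eq_zero_iff_of_nonneg (hzf v hv)).1
      ((mul_eq_zero.1 (hterm0 v)).resolve_left h1) w ((mem_neighborFinset _ _ _).2 hw)
  have hall : ∀ v ∈ K, z v < 0 := by
    refine hK.forall_of_adj (fun v => z v < 0) hneg ?_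
    intro v hv hzv w hw hvw
    have h1 := hnb v hv hzv w hvw
    rcases (hfnn w).lt_or_eq with h2 | h2
    · linarith
    · have h3 := hray.sum_neighborFinset_eq hf0 (by linarith) hw
      rw [← h2, mul_zero, Finset.sum_eq_zero_iff_of_nonneg fun u _ => hfnn u] at h3
      have h4 := h3 v ((mem_neighborFinset _ _ _).2 hvw.symm)
      rw [hfneg v hv hzv] at h4
      linarith
  refine ⟨hall, fun v hv => ⟨fun h => ?_, fun h => ?_⟩⟩
  · simpa [hfa] using hnb v hv (hall v hv) a h
  · simpa [hfb] using hnb v hv (hall v hv) b h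

namespace IsSpectralEmbedding

variable {H : Type*} [NormedAddCommGroup H] [InnerProductSpace ℝ H] {θ : ℝ} {e : V → H}

theorem sum_inner_neighbor (he : G.IsSpectralEmbedding θ e) (Y : H) (v : V) :
    ∑ w ∈ G.neighborFinset v, inner ℝ (e w) Y = θ * inner ℝ (e v) Y := by
  rw [← _root_.sum_inner, he.sum_neighbor, real_inner_smul_left]

theorem inner_self (he : G.IsSpectralEmbedding θ e) (v : V) : inner ℝ (e v) (e v) = (1 : ℝ) := by
  rw [real_inner_self_eq_norm_sq, he.norm_eq, one_pow]

/-- If the subgraph induced on `K` has a negative eigenvector for `θ`, then `e a` and `e b` are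
antipodal: pairing this eigenvector with `e` gives a linear relation between `e a` and `e b` with
coefficients of the same sign. -/
theorem inner_eq_neg_one (he : G.IsSpectralEmbedding θ e) (hG : G.Connected) {a b : V}
    (hab : a ≠ b) {K : Finset V} (hK : G.IsPairComponent a b K) {z : V → ℝ}
    (hz : ∀ v ∈ K, ∑ w ∈ G.neighborFinset v, z w = θ * z v) (hneg : ∀ v ∈ K, z v < 0)
    (hbd : ∀ v ∈ K, (G.Adj v a → z a = 0) ∧ (G.Adj v b → z b = 0)) :
    inner ℝ (e a) (e b) = (-1 : ℝ) := by
  classical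
  let f : V → ℝ := fun v => if v ∈ K then -z v else 0
  have hfK : ∀ v ∈ K, f v = -z v := fun v hv => if_pos hv
  have hf0 : ∀ v, v ∉ K → f v = 0 := fun v hv => if_neg hv
  have hfnn : ∀ v, 0 ≤ f v := fun v => by
    by_cases hv : v ∈ K
    · rw [hfK v hv]; linarith [hneg v hv]
    · rw [hf0 v hv]
  have hfeq : ∀ v ∈ K, ∑ w ∈ G.neighborFinset v, f w = θ * f v := by
    intro v hv
    rw [hfK v hv, mul_neg, ← hz v hv, ← Finset.sum_neg_distrib]
    refine Finset.sum_congr rfl fun w hw => ?_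
    have hvw := (mem_neighborFinset _ _ _).1 hw
    rcases hK.mem_of_adj v hv w hvw with h | rfl | rfl
    · exact hfK w h
    · rw [hf0 _ hK.left_notMem, (hbd v hv).1 hvw, neg_zero]
    · rw [hf0 _ hK.right_notMem, (hbd v hv).2 hvw, neg_zero]
  set p := ∑ w ∈ G.neighborFinset a, f w with hp
  set q := ∑ w ∈ G.neighborFinset b, f w with hq
  have hp0 : 0 ≤ p := Finset.sum_nonneg fun w _ => hfnn w
  have hq0 : 0 ≤ q := Finset.sum_nonneg fun w _ => hfnn w
  have hpq : 0 < p + q := by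
    obtain ⟨v, hv, h⟩ := hK.exists_adj hG
    have hfv : 0 < f v := by rw [hfK v hv]; linarith [hneg v hv]
    rcases h with h | h
    · have : f v ≤ p := Finset.single_le_sum (fun w _ => hfnn w)
        ((mem_neighborFinset _ _ _).2 h.symm)
      linarith
    · have : f v ≤ q := Finset.single_le_sum (fun w _ => hfnn w)
        ((mem_neighborFinset _ _ _).2 h.symm)
      linarith
  have key : ∀ Y : H, inner ℝ (e a) Y * p + inner ℝ (e b) Y * q = 0 := by
    intro Y
    have h1 := sum_mul_sum_neighborFinset_comm (G := G) f fun v => inner ℝ (e v) Y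
    have h2 : ∑ v, (inner ℝ (e v) Y * ∑ w ∈ G.neighborFinset v, f w
        - f v * ∑ w ∈ G.neighborFinset v, inner ℝ (e w) Y) = 0 := by
      rw [Finset.sum_sub_distrib, h1, sub_self]
    rw [Finset.sum_eq_add a b hab] at h2
    · simpa [hf0 a hK.left_notMem, hf0 b hK.right_notMem] using h2
    · intro v _ hv
      by_cases hvK : v ∈ K
      · rw [hfeq v hvK, he.sum_inner_neighbor]
        ring
      · rw [hf0 v hvK, zero_mul, sub_zero, Finset.sum_eq_zero, mul_zero]
        intro w hw
        refine hf0 w fun hwK => ?_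
        rcases hK.mem_of_adj w hwK v ((mem_neighborFinset _ _ _).1 hw).symm with h | h
        · exact hvK h
        · exact h.elim hv.1 hv.2
    · simp
    · simp
  have h1 := key (e a)
  have h2 := key (e b)
  rw [he.inner_self, real_inner_comm] at h1
  rw [he.inner_self] at h2
  have h3 : (p + q) * (inner ℝ (e a) (e b) + 1) = 0 := by linear_combination h1 + h2
  have := (mul_eq_zero.1 h3).resolve_left hpq.ne'
  linarith

end IsSpectralEmbedding

end SimpleGraph

/-! ### The spectral embedding maps a component into an arc -/

namespace SimpleGraph.IsSpectralEmbedding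

variable {V : Type*} [Fintype V] {G : SimpleGraph V} [DecidableRel G.Adj]
  {H : Type*} [NormedAddCommGroup H] [InnerProductSpace ℝ H] {θ : ℝ} {e : V → H}

/-- The part of `e v` orthogonal to the unit vector `e a`. -/
noncomputable def residual (e : V → H) (a v : V) : H := e v - (inner ℝ (e a) (e v) : ℝ) • e a

theorem inner_residual_left (he : G.IsSpectralEmbedding θ e) (a v : V) :
    inner ℝ (e a) (residual e a v) = (0 : ℝ) := by
  rw [residual, inner_sub_right, real_inner_smul_right, he.inner_self, mul_one, sub_self]

theorem residual_self (he : G.IsSpectralEmbedding θ e) (a : V) : residual e a a = 0 := by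
  rw [residual, he.inner_self, one_smul, sub_self]

theorem inner_left_residual (he : G.IsSpectralEmbedding θ e) (a u v : V) :
    inner ℝ (e u) (residual e a v) = (inner ℝ (residual e a u) (residual e a v) : ℝ) := by
  conv_rhs => rw [residual, inner_sub_left, real_inner_smul_left, he.inner_residual_left,
    mul_zero, sub_zero]

theorem inner_eq_residual (he : G.IsSpectralEmbedding θ e) (a u v : V) :
    inner ℝ (e u) (e v) = (inner ℝ (e a) (e u) * inner ℝ (e a) (e v) +
      inner ℝ (residual e a u) (residual e a v) : ℝ) := by
  rw [← he.inner_left_residual, residual, inner_sub_right, real_inner_smul_right,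
    real_inner_comm (e a) (e u)]
  ring

theorem sq_add_norm_residual_sq (he : G.IsSpectralEmbedding θ e) (a v : V) :
    (inner ℝ (e a) (e v) : ℝ) ^ 2 + ‖residual e a v‖ ^ 2 = 1 := by
  rw [← real_inner_self_eq_norm_sq, ← he.inner_self v, he.inner_eq_residual a v v]
  ring

theorem abs_inner_le_one (he : G.IsSpectralEmbedding θ e) (u v : V) :
    |(inner ℝ (e u) (e v) : ℝ)| ≤ 1 := by
  simpa [he.norm_eq] using abs_real_inner_le_norm (e u) (e v)

theorem eq_of_inner_eq_one (he : G.IsSpectralEmbedding θ e) {u v : V}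
    (h : inner ℝ (e u) (e v) = (1 : ℝ)) : e u = e v :=
  (inner_eq_one_iff_of_norm_eq_one (he.norm_eq u) (he.norm_eq v)).1 h

theorem residual_eq_zero_of_inner_eq_neg_one (he : G.IsSpectralEmbedding θ e) {a b : V}
    (h : inner ℝ (e a) (e b) = (-1 : ℝ)) : residual e a b = 0 := by
  have := he.sq_add_norm_residual_sq a b
  rw [h] at this
  have h1 : ‖residual e a b‖ ^ 2 = 0 := by linarith
  simpa using h1

section

variable {a b : V} {K : Finset V}

/-- The minimum principle without its exceptional case. -/
theorem inner_nonneg (he : G.IsSpectralEmbedding θ e) (hG : G.Connected)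
    (hab : a ≠ b) (hK : G.IsPairComponent a b K) (hray : G.RayleighLE K θ)
    (ht : inner ℝ (e a) (e b) ≠ (-1 : ℝ)) {Y : H} (ha : 0 ≤ (inner ℝ (e a) Y : ℝ))
    (hb : 0 ≤ (inner ℝ (e b) Y : ℝ)) {v : V} (hv : v ∈ K) : 0 ≤ (inner ℝ (e v) Y : ℝ) := by
  rcases hK.nonneg_or_neg hray (fun v _ => he.sum_inner_neighbor Y v) ha hb with h | h
  · exact h v hv
  · exact absurd (he.inner_eq_neg_one hG hab hK (fun v _ => he.sum_inner_neighbor Y v) h.1 h.2) ht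

theorem inner_eq_zero (he : G.IsSpectralEmbedding θ e) (hG : G.Connected)
    (hab : a ≠ b) (hK : G.IsPairComponent a b K) (hray : G.RayleighLE K θ)
    (ht : inner ℝ (e a) (e b) ≠ (-1 : ℝ)) {Y : H} (ha : inner ℝ (e a) Y = (0 : ℝ))
    (hb : inner ℝ (e b) Y = (0 : ℝ)) {v : V} (hv : v ∈ K) : inner ℝ (e v) Y = (0 : ℝ) := by
  refine le_antisymm ?_ (he.inner_nonneg hG hab hK hray ht ha.ge hb.ge hv)
  have := he.inner_nonneg hG hab hK hray ht (Y := -Y) (by simp [ha]) (by simp [hb]) hv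
  simpa using this

/-- If `e a` and `e b` are not antipodal, every residual on `K` is a nonnegative multiple of that of
`b`: functionals vanishing at `e a` and `e b` vanish on `K`, and the functional given by the residual
of `b` is nonnegative on `K`. -/
theorem inner_residual_right (he : G.IsSpectralEmbedding θ e) (hG : G.Connected)
    (hab : a ≠ b) (hK : G.IsPairComponent a b K) (hray : G.RayleighLE K θ)
    (ht : inner ℝ (e a) (e b) ≠ (-1 : ℝ)) {v : V} (hv : v ∈ K) :
    inner ℝ (residual e a v) (residual e a b) =
      ‖residual e a v‖ * ‖residual e a b‖ ∧
    (residual e a b = 0 → residual e a v = 0) := by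
  set r := residual e a v with hr
  set s := residual e a b with hs
  have hnn : 0 ≤ (inner ℝ r s : ℝ) := by
    rw [← he.inner_left_residual]
    refine he.inner_nonneg hG hab hK hray ht (he.inner_residual_left a b).ge ?_ hv
    rw [he.inner_left_residual, real_inner_self_eq_norm_sq]
    positivity
  constructor
  · have h1 : (inner ℝ (e v) (‖s‖ ^ 2 • r - (inner ℝ r s : ℝ) • s) : ℝ) = 0 := by
      refine he.inner_eq_zero hG hab hK hray ht ?_ ?_ hv
      · rw [inner_sub_right, real_inner_smul_right, real_inner_smul_right,
          he.inner_residual_left, he.inner_residual_left]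
        ring
      · rw [inner_sub_right, real_inner_smul_right, real_inner_smul_right,
          he.inner_left_residual, he.inner_left_residual, ← hr, ← hs,
          real_inner_self_eq_norm_sq, real_inner_comm]
        ring
    rw [inner_sub_right, real_inner_smul_right, real_inner_smul_right, he.inner_left_residual,
      he.inner_left_residual, ← hr, ← hs, real_inner_self_eq_norm_sq] at h1
    have h2 : (inner ℝ r s : ℝ) ^ 2 = (‖r‖ * ‖s‖) ^ 2 := by linarith
    exact (sq_eq_sq₀ hnn (by positivity)).1 h2
  · intro hs0
    have h1 : (inner ℝ (e v) r : ℝ) = 0 := by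
      refine he.inner_eq_zero hG hab hK hray ht (he.inner_residual_left a v) ?_ hv
      rw [he.inner_left_residual, ← hs, hs0, inner_zero_left]
    rw [he.inner_left_residual, ← hr, real_inner_self_eq_norm_sq] at h1
    simpa using h1

/-- All residuals on `K ∪ {b}` lie on a common ray. -/
theorem inner_residual (he : G.IsSpectralEmbedding θ e) (hG : G.Connected)
    (hab : a ≠ b) (hK : G.IsPairComponent a b K) (hray : G.RayleighLE K θ) {u v : V}
    (hu : u ∈ K ∨ u = b) (hv : v ∈ K ∨ v = b) :
    inner ℝ (residual e a u) (residual e a v) = ‖residual e a u‖ * ‖residual e a v‖ := by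
  by_cases ht : inner ℝ (e a) (e b) = (-1 : ℝ)
  · have hb0 := he.residual_eq_zero_of_inner_eq_neg_one ht
    rcases hu with hu | rfl
    · rcases hv with hv | rfl
      · -- A functional vanishing at `e a` and `e b` has a constant sign on `K`, while the
        -- functional `Y` below is nonnegative at `v` and nonpositive at `u`.
        set r := residual e a u with hr
        set s := residual e a v with hs
        by_cases hr0 : r = 0
        · simp [hr0]
        have hYa : inner ℝ (e a) (‖r‖ • s - ‖s‖ • r) = (0 : ℝ) := by
          rw [inner_sub_right, real_inner_smul_right, real_inner_smul_right,
            he.inner_residual_left, he.inner_residual_left]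
          ring
        have hYb : inner ℝ (e b) (‖r‖ • s - ‖s‖ • r) = (0 : ℝ) := by
          rw [inner_sub_right, real_inner_smul_right, real_inner_smul_right,
            he.inner_left_residual, he.inner_left_residual, hb0, inner_zero_left, inner_zero_left]
          ring
        have hYu : (inner ℝ (e u) (‖r‖ • s - ‖s‖ • r) : ℝ) =
            ‖r‖ * (inner ℝ r s - ‖r‖ * ‖s‖) := by
          rw [inner_sub_right, real_inner_smul_right, real_inner_smul_right,
            he.inner_left_residual, he.inner_left_residual, ← hr, ← hs,
            real_inner_self_eq_norm_sq]
          ring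
        have hYv : (inner ℝ (e v) (‖r‖ • s - ‖s‖ • r) : ℝ) =
            ‖s‖ * (‖r‖ * ‖s‖ - inner ℝ r s) := by
          rw [inner_sub_right, real_inner_smul_right, real_inner_smul_right,
            he.inner_left_residual, he.inner_left_residual, ← hr, ← hs,
            real_inner_self_eq_norm_sq, real_inner_comm r s]
          ring
        have hcs := real_inner_le_norm r s
        have hrpos : 0 < ‖r‖ := norm_pos_iff.2 hr0
        rcases hK.nonneg_or_neg hray (fun w _ => he.sum_inner_neighbor (‖r‖ • s - ‖s‖ • r) w)
          hYa.ge hYb.ge with h | h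
        · have h1 := h u hu
          rw [hYu] at h1
          have h2 := nonneg_of_mul_nonneg_right h1 hrpos
          linarith
        · have h1 := h.1 v hv
          rw [hYv] at h1
          nlinarith [mul_nonneg (norm_nonneg s) (sub_nonneg.2 hcs)]
      · simp [hb0]
    · simp [hb0]
  · have key : ∀ w, w ∈ K ∨ w = b →
        inner ℝ (residual e a w) (residual e a b) = ‖residual e a w‖ * ‖residual e a b‖ ∧
        (residual e a b = 0 → residual e a w = 0) := by
      rintro w (hw | rfl)
      · exact he.inner_residual_right hG hab hK hray ht hw
      · exact ⟨by rw [real_inner_self_eq_norm_sq, pow_two], id⟩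
    by_cases hb0 : residual e a b = 0
    · simp [(key u hu).2 hb0]
    · have hbpos : 0 < ‖residual e a b‖ := norm_pos_iff.2 hb0
      have h1 := inner_eq_norm_mul_iff_real.1 (key u hu).1
      have h2 := inner_eq_norm_mul_iff_real.1 (key v hv).1
      have h3 : ‖residual e a b‖ ^ 2 * (inner ℝ (residual e a u) (residual e a v) : ℝ) =
          ‖residual e a b‖ ^ 2 * (‖residual e a u‖ * ‖residual e a v‖) := by
        calc ‖residual e a b‖ ^ 2 * (inner ℝ (residual e a u) (residual e a v) : ℝ)
            = inner ℝ (‖residual e a b‖ • residual e a u) (‖residual e a b‖ • residual e a v) := by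
              rw [real_inner_smul_left, real_inner_smul_right]
              ring
          _ = _ := by
              rw [h1, h2, real_inner_smul_left, real_inner_smul_right, real_inner_self_eq_norm_sq]
              ring
      exact mul_left_cancel₀ (by positivity) h3

/-- The angle from `e a` to `e v`. -/
noncomputable def angle (e : V → H) (a v : V) : ℝ := Real.arccos (inner ℝ (e a) (e v))

theorem angle_self (he : G.IsSpectralEmbedding θ e) (a : V) : angle e a a = 0 := by
  rw [angle, he.inner_self, Real.arccos_one]

theorem cos_angle (he : G.IsSpectralEmbedding θ e) (a v : V) :
    Real.cos (angle e a v) = inner ℝ (e a) (e v) :=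
  Real.cos_arccos (abs_le.1 (he.abs_inner_le_one a v)).1 (abs_le.1 (he.abs_inner_le_one a v)).2

theorem sin_angle (he : G.IsSpectralEmbedding θ e) (a v : V) :
    Real.sin (angle e a v) = ‖residual e a v‖ := by
  rw [angle, Real.sin_arccos, ← Real.sqrt_sq (norm_nonneg (residual e a v))]
  congr 1
  linarith [he.sq_add_norm_residual_sq a v]

theorem inner_eq_cos (he : G.IsSpectralEmbedding θ e) (hG : G.Connected)
    (hab : a ≠ b) (hK : G.IsPairComponent a b K) (hray : G.RayleighLE K θ) {u v : V}
    (hu : u ∈ K ∨ u = a ∨ u = b) (hv : v ∈ K ∨ v = a ∨ v = b) :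
    inner ℝ (e u) (e v) = Real.cos (angle e a u - angle e a v) := by
  rw [Real.cos_sub, he.cos_angle, he.cos_angle, he.sin_angle, he.sin_angle,
    he.inner_eq_residual a u v]
  congr 1
  rcases eq_or_ne u a with rfl | hua
  · simp [he.residual_self]
  rcases eq_or_ne v a with rfl | hva
  · simp [he.residual_self]
  exact he.inner_residual hG hab hK hray (hu.imp_right fun h => h.resolve_left hua)
    (hv.imp_right fun h => h.resolve_left hva)

theorem sum_sin (he : G.IsSpectralEmbedding θ e) (hG : G.Connected)
    (hab : a ≠ b) (hK : G.IsPairComponent a b K) (hray : G.RayleighLE K θ) {v : V}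
    (hv : v ∈ K) :
    ∑ w ∈ G.neighborFinset v, Real.sin (angle e a w - angle e a v) = 0 := by
  have hres : ∀ u w, (u ∈ K ∨ u = a ∨ u = b) → (w ∈ K ∨ w = a ∨ w = b) →
      inner ℝ (residual e a u) (residual e a w) = ‖residual e a u‖ * ‖residual e a w‖ := by
    intro u w hu hw
    have := he.inner_eq_cos hG hab hK hray hu hw
    rw [Real.cos_sub, he.cos_angle, he.cos_angle, he.sin_angle, he.sin_angle,
      he.inner_eq_residual a u w] at this
    linarith
  have hcos : ∑ w ∈ G.neighborFinset v, (inner ℝ (e a) (e w) : ℝ) = θ * inner ℝ (e a) (e v) := by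
    simpa only [real_inner_comm] using he.sum_inner_neighbor (e a) v
  have hmem : ∀ w ∈ G.neighborFinset v, w ∈ K ∨ w = a ∨ w = b := fun w hw =>
    hK.mem_of_adj v hv w ((mem_neighborFinset _ _ _).1 hw)
  have hsin : ∑ w ∈ G.neighborFinset v, ‖residual e a w‖ = θ * ‖residual e a v‖ := by
    by_cases h : ∃ u, (u ∈ K ∨ u = a ∨ u = b) ∧ residual e a u ≠ 0
    · obtain ⟨u, hu, hu0⟩ := h
      have h1 := he.sum_inner_neighbor (residual e a u) v
      simp only [he.inner_left_residual] at h1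
      rw [hres v u (Or.inl hv) hu,
        Finset.sum_congr rfl fun w hw => hres w u (hmem w hw) hu, ← Finset.sum_mul,
        ← mul_assoc] at h1
      exact mul_right_cancel₀ (norm_ne_zero_iff.2 hu0) h1
    · push Not at h
      rw [h v (Or.inl hv), norm_zero, mul_zero]
      exact Finset.sum_eq_zero fun w hw => by rw [h w (hmem w hw), norm_zero]
  simp only [Real.sin_sub, he.cos_angle, he.sin_angle]
  rw [Finset.sum_sub_distrib, ← Finset.sum_mul, ← Finset.sum_mul, hsin, hcos]
  ring

/-- The vertices of `K` are mapped between `e a` and `e b`. -/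
theorem angle_le (he : G.IsSpectralEmbedding θ e) (hG : G.Connected)
    (hab : a ≠ b) (hK : G.IsPairComponent a b K) (hray : G.RayleighLE K θ) {v : V}
    (hv : v ∈ K) : angle e a v ≤ angle e a b := by
  by_cases ht : inner ℝ (e a) (e b) = (-1 : ℝ)
  · rw [angle, angle, ht, Real.arccos_neg_one]
    exact Real.arccos_le_pi _
  refine Real.antitone_arccos ?_
  have hres := he.inner_residual_right hG hab hK hray ht hv
  set t : ℝ := inner ℝ (e a) (e b) with ht'
  set x : ℝ := inner ℝ (e a) (e v) with hx
  have hb1 := he.sq_add_norm_residual_sq a b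
  have hv1 := he.sq_add_norm_residual_sq a v
  rw [← ht'] at hb1
  rw [← hx] at hv1
  by_cases hb0 : residual e a b = 0
  · have h1 : t = 1 := by
      have : (t - 1) * (t + 1) = 0 := by
        rw [hb0, norm_zero] at hb1
        linarith
      rcases mul_eq_zero.1 this with h | h
      · linarith
      · exact absurd (by linarith) ht
    have h2 : 0 ≤ x := by
      rw [hx, real_inner_comm]
      refine he.inner_nonneg hG hab hK hray ht ?_ ?_ hv
      · rw [he.inner_self]; exact zero_le_one
      · rw [real_inner_comm, ← ht', h1]; exact zero_le_one
    rw [hres.2 hb0, norm_zero] at hv1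
    nlinarith
  · have hbpos : 0 < ‖residual e a b‖ := norm_pos_iff.2 hb0
    have h1 : 0 ≤ (inner ℝ (e v) (e a - t • e b) : ℝ) := by
      refine he.inner_nonneg hG hab hK hray ht ?_ ?_ hv
      · rw [inner_sub_right, real_inner_smul_right, he.inner_self, ← ht']
        nlinarith [sq_nonneg ‖residual e a b‖]
      · rw [inner_sub_right, real_inner_smul_right, he.inner_self, real_inner_comm, ← ht']
        linarith
    rw [inner_sub_right, real_inner_smul_right, he.inner_eq_residual a v b, hres.1, ← ht',
      ← hx, real_inner_comm, ← hx] at h1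
    have h2 : 0 ≤ ‖residual e a b‖ * (‖residual e a b‖ * x - t * ‖residual e a v‖) := by
      have : ‖residual e a b‖ ^ 2 * x = x - t ^ 2 * x := by
        linear_combination x * hb1
      nlinarith
    have h3 := nonneg_of_mul_nonneg_right h2 hbpos
    -- `h3` says that the angle from `e v` to `e b` has nonnegative sine.
    have h4 : 0 ≤ Real.sin (angle e a b - angle e a v) := by
      rw [Real.sin_sub, he.sin_angle, he.sin_angle, he.cos_angle, he.cos_angle, ← ht', ← hx]
      linarith
    by_contra! hlt
    have hlt' : angle e a b < angle e a v := Real.arccos_lt_arccos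
      (abs_le.1 (he.abs_inner_le_one a v)).1 hlt (abs_le.1 (he.abs_inner_le_one a b)).2
    have hb2 : angle e a b ≠ 0 := by
      intro h
      have := he.sin_angle a b
      rw [h, Real.sin_zero] at this
      exact hbpos.ne this
    have hb3 : 0 < angle e a b := lt_of_le_of_ne (Real.arccos_nonneg _) hb2.symm
    have hv3 : angle e a v ≤ Real.pi := Real.arccos_le_pi _
    have := Real.sin_neg_of_neg_of_neg_pi_lt (sub_neg.2 hlt') (by linarith)
    linarith

end

end SimpleGraph.IsSpectralEmbedding

/-! ### Components embedded in an arc -/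

namespace IsColourConstant

variable {V κ : Type*} [Fintype V] {c : V → V → κ}

theorem exists_of_exists (hc : IsCoherentColouring c) {P : V → V → Prop}
    (hP : IsColourConstant c P) {v : V} (h : ∃ w, P v w) (v' : V) : ∃ w, P v' w := by
  classical
  have h1 : 0 < (Finset.univ.filter (P v)).card := by
    obtain ⟨w, hw⟩ := h
    exact Finset.card_pos.2 ⟨w, by simpa using hw⟩
  rw [hP.card_filter_eq hc v v'] at h1
  obtain ⟨w, hw⟩ := Finset.card_pos.1 h1
  exact ⟨w, by simpa using hw⟩

theorem unique_of_unique (hc : IsCoherentColouring c) {P : V → V → Prop}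
    (hP : IsColourConstant c P) {v : V} (h : ∀ w w', P v w → P v w' → w = w') (v' : V) :
    ∀ w w', P v' w → P v' w' → w = w' := by
  classical
  have h1 : (Finset.univ.filter (P v)).card ≤ 1 :=
    Finset.card_le_one.2 fun w hw w' hw' => h w w' (by simpa using hw) (by simpa using hw')
  rw [hP.card_filter_eq hc v v'] at h1
  exact fun w w' hw hw' => Finset.card_le_one.1 h1 w (by simpa using hw) w' (by simpa using hw')

end IsColourConstant

theorem Real.lt_of_sin_lt_sin_of_add_le_pi {x y : ℝ} (hy : 0 ≤ y)
    (hxy : x + y ≤ Real.pi) (h : Real.sin x < Real.sin y) : x < y := by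
  by_contra! hle
  rcases le_total x (Real.pi / 2) with hx | hx
  · have := Real.sin_le_sin_of_le_of_le_pi_div_two (by linarith [Real.pi_pos]) hx hle
    linarith
  · have := Real.sin_le_sin_of_le_of_le_pi_div_two (x := y) (y := Real.pi - x)
      (by linarith [Real.pi_pos]) (by linarith) (by linarith)
    rw [Real.sin_pi_sub] at this
    linarith

namespace SimpleGraph

variable {V : Type*} [Fintype V] {G : SimpleGraph V} [DecidableRel G.Adj]

/-- Every vertex of `K ∪ {a, b}` sits at an angle `φ` between those of `a` and `b`, the values of
`E` are the cosines of the angle differences, and the neighbours of each vertex of `K` balance. -/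
structure IsArc (G : SimpleGraph V) [DecidableRel G.Adj] (a b : V) (K : Finset V)
    (E : V → V → ℝ) (φ : V → ℝ) : Prop where
  angle_left : φ a = 0
  angle_right_nonneg : 0 ≤ φ b
  angle_right_le : φ b ≤ Real.pi
  angle_nonneg : ∀ v ∈ K, 0 ≤ φ v
  angle_le : ∀ v ∈ K, φ v ≤ φ b
  eq_cos : ∀ u v, (u ∈ K ∨ u = a ∨ u = b) → (v ∈ K ∨ v = a ∨ v = b) →
    E u v = Real.cos (φ u - φ v)
  sum_sin : ∀ v ∈ K, ∑ w ∈ G.neighborFinset v, Real.sin (φ w - φ v) = 0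

theorem IsSpectralEmbedding.isArc {H : Type*} [NormedAddCommGroup H] [InnerProductSpace ℝ H]
    {θ : ℝ} {e : V → H} (he : G.IsSpectralEmbedding θ e) (hG : G.Connected) {a b : V}
    {K : Finset V} (hab : a ≠ b) (hK : G.IsPairComponent a b K) (hray : G.RayleighLE K θ) :
    G.IsArc a b K (fun v w => inner ℝ (e v) (e w)) (angle e a) where
  angle_left := he.angle_self a
  angle_right_nonneg := Real.arccos_nonneg _
  angle_right_le := Real.arccos_le_pi _
  angle_nonneg _ _ := Real.arccos_nonneg _
  angle_le _ hv := he.angle_le hG hab hK hray hv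
  eq_cos _ _ hu hv := he.inner_eq_cos hG hab hK hray hu hv
  sum_sin _ hv := he.sum_sin hG hab hK hray hv

namespace IsArc

variable {a b : V} {K : Finset V} {E : V → V → ℝ} {φ : V → ℝ}

theorem mem_Icc (hA : G.IsArc a b K E φ) {v : V} (hv : v ∈ K ∨ v = a ∨ v = b) :
    0 ≤ φ v ∧ φ v ≤ φ b := by
  rcases hv with hv | rfl | rfl
  · exact ⟨hA.angle_nonneg v hv, hA.angle_le v hv⟩
  · rw [hA.angle_left]
    exact ⟨le_rfl, hA.angle_right_nonneg⟩
  · exact ⟨hA.angle_right_nonneg, le_rfl⟩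

/-- A cosine between `0` and `π` determines the distance of two angles. -/
theorem abs_sub_eq (hA : G.IsArc a b K E φ) {u v : V} (hu : u ∈ K ∨ u = a ∨ u = b)
    (hv : v ∈ K ∨ v = a ∨ v = b) {τ : ℝ} (h0 : 0 ≤ τ) (h1 : τ ≤ Real.pi)
    (h : E u v = Real.cos τ) : |φ u - φ v| = τ := by
  rw [hA.eq_cos u v hu hv, ← Real.cos_abs] at h
  have hu' := hA.mem_Icc hu
  have hv' := hA.mem_Icc hv
  have := hA.angle_right_le
  refine Real.injOn_cos ⟨abs_nonneg _, abs_le.2 ⟨?_, ?_⟩⟩ ⟨h0, h1⟩ h <;> linarith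

theorem angle_eq (hA : G.IsArc a b K E φ) {u v : V} (hu : u ∈ K ∨ u = a ∨ u = b)
    (hv : v ∈ K ∨ v = a ∨ v = b) (h : E u v = 1) : φ u = φ v := by
  have := hA.abs_sub_eq hu hv le_rfl Real.pi_pos.le (by rw [h, Real.cos_zero])
  rw [abs_eq_zero] at this
  linarith

/-- If a vertex of `K` sits at an end of the arc, then every vertex sits at one of two antipodal
points. Counting the edges between `K` and `{a, b}` then shows that the degree is two. -/
theorem degree_le_two_of_endpoint {κ : Type*} {c : V → V → κ} (hA : G.IsArc a b K E φ)
    (hc : IsCoherentColouring c)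
    (hadj : IsColourConstant c G.Adj) (hE : IsColourConstant c E) {d : ℕ}
    (hd : ∀ v, G.degree v = d) (hK : G.IsPairComponent a b K) (hab : a ≠ b) {θ : ℝ}
    (hray : G.RayleighLE K θ) (hθ : ∀ v, ∑ w ∈ G.neighborFinset v, E v w = θ)
    (hne : ∀ v, ∃ w, G.Adj v w ∧ E v w ≠ 1) {v₀ : V} (hv₀ : v₀ ∈ K)
    (h₀ : φ v₀ = 0 ∨ φ v₀ = φ b) : d ≤ 2 := by
  classical
  by_contra! hd3
  have hpi := hA.angle_right_le
  have hmem : ∀ v ∈ K, ∀ w, G.Adj v w → w ∈ K ∨ w = a ∨ w = b := hK.mem_of_adj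
  have hsin0 : ∀ w ∈ G.neighborFinset v₀, Real.sin (φ w - φ v₀) = 0 := by
    rcases h₀ with h | h
    · refine (Finset.sum_eq_zero_iff_of_nonneg fun w hw => ?_).1 (hA.sum_sin v₀ hv₀)
      have hw' := hA.mem_Icc (hmem v₀ hv₀ w ((mem_neighborFinset _ _ _).1 hw))
      exact Real.sin_nonneg_of_nonneg_of_le_pi (by linarith) (by linarith)
    · refine (Finset.sum_eq_zero_iff_of_nonpos fun w hw => ?_).1 (hA.sum_sin v₀ hv₀)
      have hw' := hA.mem_Icc (hmem v₀ hv₀ w ((mem_neighborFinset _ _ _).1 hw))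
      exact Real.sin_nonpos_of_nonpos_of_neg_pi_le (by linarith) (by linarith)
  have hpm : ∀ v w, G.Adj v w → E v w = 1 ∨ E v w = -1 := by
    by_contra! h
    obtain ⟨v, w, h1, h2⟩ := h
    obtain ⟨u, hu, hu'⟩ := IsColourConstant.exists_of_exists hc
      (hadj.comp₂ hE fun p r => p ∧ (r ≠ 1 ∧ r ≠ -1)) ⟨w, h1, h2⟩ v₀
    have h3 := hsin0 u ((mem_neighborFinset _ _ _).2 hu)
    rw [hA.eq_cos v₀ u (Or.inl hv₀) (hmem v₀ hv₀ u hu), ← Real.cos_neg, neg_sub] at hu'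
    rcases Real.sin_eq_zero_iff_cos_eq.1 h3 with h4 | h4
    · exact hu'.1 h4
    · exact hu'.2 h4
  have hanti : ∀ v, ∃ w, G.Adj v w ∧ E v w = -1 := fun v => by
    obtain ⟨w, hw, hw'⟩ := hne v
    exact ⟨w, hw, (hpm v w hw).resolve_left hw'⟩
  have hang : ∀ v ∈ K, (φ v = 0 ∨ φ v = Real.pi) ∧ φ b = Real.pi := by
    intro v hv
    obtain ⟨w, hw, hw'⟩ := hanti v
    have h1 := hA.abs_sub_eq (Or.inl hv) (hmem v hv w hw) Real.pi_pos.le le_rfl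
      (by rw [hw', Real.cos_pi])
    have hv' := hA.mem_Icc (Or.inl hv)
    have hw' := hA.mem_Icc (hmem v hv w hw)
    rcases abs_eq Real.pi_pos.le |>.1 h1 with h2 | h2
    · exact ⟨Or.inr (by linarith), by linarith⟩
    · exact ⟨Or.inl (by linarith), by linarith⟩
  -- Each vertex has `μ ≥ 1` antipodal neighbours, so that `θ = d - 2 μ ≤ d - 2`.
  have hμ : ∀ v, θ = d - 2 * ((G.neighborFinset v).filter fun w => E v w = -1).card := by
    intro v
    have h1 : ∀ w ∈ G.neighborFinset v, E v w = 1 - 2 * if E v w = -1 then 1 else 0 := by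
      intro w hw
      rcases hpm v w ((mem_neighborFinset _ _ _).1 hw) with h | h <;> rw [h] <;> norm_num
    rw [← hθ v, Finset.sum_congr rfl h1, Finset.sum_sub_distrib, ← Finset.mul_sum,
      Finset.sum_boole, Finset.sum_const, card_neighborFinset_eq_degree, hd]
    simp
  have hμ1 : ∀ v, 1 ≤ ((G.neighborFinset v).filter fun w => E v w = -1).card := by
    intro v
    obtain ⟨w, hw, hw'⟩ := hanti v
    exact Finset.card_pos.2 ⟨w, by simpa using ⟨hw, hw'⟩⟩
  have hout : ∀ v ∈ K, d ≤ (G.neighborFinset v ∩ K).card + (G.neighborFinset v ∩ {a, b}).card := by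
    intro v hv
    rw [← hd v, ← card_neighborFinset_eq_degree]
    refine (Finset.card_le_card fun w hw => ?_).trans (Finset.card_union_le _ _)
    rcases hmem v hv w ((mem_neighborFinset _ _ _).1 hw) with h | h | h <;> simp_all
  have hle2 : ∀ v, (G.neighborFinset v ∩ {a, b}).card ≤ 2 := fun v =>
    (Finset.card_le_card Finset.inter_subset_right).trans Finset.card_le_two
  have hray1 : ∑ v ∈ K, ((G.neighborFinset v ∩ K).card : ℝ) ≤ θ * K.card := by
    have h1 := hray (fun v => if v ∈ K then 1 else 0) (fun v hv => if_neg hv)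
    simpa [← Finset.sum_filter, Finset.filter_mem_eq_inter] using h1
  have hge : ∀ v ∈ K, (d : ℝ) - 2 ≤ (G.neighborFinset v ∩ K).card := by
    intro v hv
    have h1 : d ≤ (G.neighborFinset v ∩ K).card + 2 := (hout v hv).trans (by have := hle2 v; omega)
    have h2 : (d : ℝ) ≤ (G.neighborFinset v ∩ K).card + 2 := by exact_mod_cast h1
    linarith
  have hθle : θ ≤ d - 2 := by
    have h1 : (1 : ℝ) ≤ ((G.neighborFinset v₀).filter fun w => E v₀ w = -1).card := by
      exact_mod_cast hμ1 v₀
    rw [hμ v₀]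
    linarith
  have hKpos : (0 : ℝ) < K.card := by exact_mod_cast Finset.card_pos.2 hK.nonempty
  have hsum_ge : ((d : ℝ) - 2) * K.card ≤ ∑ v ∈ K, ((G.neighborFinset v ∩ K).card : ℝ) := by
    have := Finset.sum_le_sum hge
    rw [Finset.sum_const, nsmul_eq_mul] at this
    linarith
  have hθeq : θ = d - 2 :=
    le_antisymm hθle (le_of_mul_le_mul_right (hsum_ge.trans hray1) hKpos)
  have hinK : ∀ v ∈ K, (d : ℝ) - 2 = (G.neighborFinset v ∩ K).card := by
    refine (Finset.sum_eq_sum_iff_of_le hge).1 (le_antisymm (Finset.sum_le_sum hge) ?_)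
    rw [Finset.sum_const, nsmul_eq_mul]
    rw [hθeq] at hray1
    linarith
  have hadjab : ∀ v ∈ K, G.Adj v a ∧ G.Adj v b := by
    intro v hv
    have h1 : d = (G.neighborFinset v ∩ K).card + 2 := by
      have : (d : ℝ) = (G.neighborFinset v ∩ K).card + 2 := by linarith [hinK v hv]
      exact_mod_cast this
    have h2 := hout v hv
    have h3 : G.neighborFinset v ∩ {a, b} = {a, b} :=
      Finset.eq_of_subset_of_card_le Finset.inter_subset_right
        (Finset.card_le_two.trans (by omega))
    rw [Finset.inter_eq_right] at h3
    exact ⟨(mem_neighborFinset _ _ _).1 (h3 (by simp)),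
      (mem_neighborFinset _ _ _).1 (h3 (by simp))⟩
  have huniq : ∀ v w w', (G.Adj v w ∧ E v w = -1) → (G.Adj v w' ∧ E v w' = -1) → w = w' := by
    intro v w w' hw hw'
    have h1 : ((G.neighborFinset v).filter fun w => E v w = -1).card ≤ 1 := by
      have h2 : (((G.neighborFinset v).filter fun w => E v w = -1).card : ℝ) = 1 := by
        linarith [hμ v]
      exact_mod_cast h2.le
    exact Finset.card_le_one.1 h1 w (by simpa using hw) w' (by simpa using hw')
  obtain ⟨w, hw, hwab⟩ : ∃ w ∈ G.neighborFinset v₀, w ∉ ({a, b} : Finset V) := by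
    by_contra! h
    have h1 := (Finset.card_le_card h).trans Finset.card_le_two
    rw [card_neighborFinset_eq_degree, hd] at h1
    omega
  rw [mem_neighborFinset] at hw
  simp only [Finset.mem_insert, Finset.mem_singleton, not_or] at hwab
  have hwK : w ∈ K := (hmem v₀ hv₀ w hw).resolve_right (not_or.2 hwab)
  have hψ := (hang v₀ hv₀).2
  have ha0 := hA.angle_left
  have hEa : ∀ v ∈ K, φ v = Real.pi → E v a = -1 ∧ E a v = -1 := by
    intro v hv h
    rw [hA.eq_cos v a (Or.inl hv) (by simp), hA.eq_cos a v (by simp) (Or.inl hv), h, ha0]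
    simp
  have hEb : ∀ v ∈ K, φ v = 0 → E v b = -1 ∧ E b v = -1 := by
    intro v hv h
    rw [hA.eq_cos v b (Or.inl hv) (by simp), hA.eq_cos b v (by simp) (Or.inl hv), h, hψ]
    simp
  have hEvw : E v₀ w = Real.cos (φ v₀ - φ w) := hA.eq_cos _ _ (Or.inl hv₀) (Or.inl hwK)
  rcases (hang v₀ hv₀).1 with h1 | h1 <;> rcases (hang w hwK).1 with h2 | h2
  · exact hw.ne (huniq b v₀ w ⟨(hadjab v₀ hv₀).2.symm, (hEb v₀ hv₀ h1).2⟩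
      ⟨(hadjab w hwK).2.symm, (hEb w hwK h2).2⟩)
  · refine hwab.2 (huniq v₀ w b ⟨hw, ?_⟩ ⟨(hadjab v₀ hv₀).2, (hEb v₀ hv₀ h1).1⟩)
    rw [hEvw, h1, h2]
    simp
  · refine hwab.1 (huniq v₀ w a ⟨hw, ?_⟩ ⟨(hadjab v₀ hv₀).1, (hEa v₀ hv₀ h1).1⟩)
    rw [hEvw, h1, h2]
    simp
  · exact hw.ne (huniq a v₀ w ⟨(hadjab v₀ hv₀).1.symm, (hEa v₀ hv₀ h1).2⟩
      ⟨(hadjab w hwK).1.symm, (hEa w hwK h2).2⟩)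

/-- A balanced vertex with a neighbour at a different angle has a neighbour at a smaller angle. -/
theorem exists_adj_angle_lt (hA : G.IsArc a b K E φ) (hK : G.IsPairComponent a b K)
    (hint : ∀ v ∈ K, 0 < φ v ∧ φ v < φ b) (hne : ∀ v, ∃ w, G.Adj v w ∧ E v w ≠ 1)
    {v : V} (hv : v ∈ K) : ∃ w, G.Adj v w ∧ φ w < φ v := by
  by_contra! h
  have hpi := hA.angle_right_le
  have hv' := hint v hv
  have h0 := (Finset.sum_eq_zero_iff_of_nonneg fun w hw => by
    rw [mem_neighborFinset] at hw
    have hw' := hA.mem_Icc (hK.mem_of_adj v hv w hw)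
    exact Real.sin_nonneg_of_nonneg_of_le_pi (sub_nonneg.2 (h w hw)) (by linarith)).1
      (hA.sum_sin v hv)
  obtain ⟨w, hw, hw1⟩ := hne v
  have hw' := hA.mem_Icc (hK.mem_of_adj v hv w hw)
  refine hw1 ?_
  rw [hA.eq_cos v w (Or.inl hv) (hK.mem_of_adj v hv w hw)]
  have hle := h w hw
  have : φ v = φ w := by
    by_contra hne'
    have := Real.sin_pos_of_pos_of_lt_pi (x := φ w - φ v)
      (sub_pos.2 (lt_of_le_of_ne hle hne')) (by linarith)
    exact this.ne' (h0 w ((mem_neighborFinset _ _ _).2 hw))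
  rw [this, sub_self, Real.cos_zero]

/-- Balance at `v`, solved for the contribution of the neighbour `u`. This is applied when `u` is the
only neighbour of `v` at a smaller angle, so that the summands on the right are nonnegative. -/
theorem sin_eq_sum_erase [DecidableEq V] (hA : G.IsArc a b K E φ) {v u : V}
    (hv : v ∈ K) (hu : G.Adj v u) :
    Real.sin (φ v - φ u) = ∑ w ∈ (G.neighborFinset v).erase u, Real.sin (φ w - φ v) := by
  have h1 := hA.sum_sin v hv
  rw [← Finset.add_sum_erase _ _ ((mem_neighborFinset _ _ _).2 hu), ← neg_sub (φ v) (φ u),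
    Real.sin_neg] at h1
  linarith

theorem sin_nonneg_of_le (hA : G.IsArc a b K E φ) {v w : V} (hv : v ∈ K)
    (hw : w ∈ K ∨ w = a ∨ w = b) (h : φ v ≤ φ w) : 0 ≤ Real.sin (φ w - φ v) := by
  have hv' := hA.angle_nonneg v hv
  have hw' := hA.mem_Icc hw
  have := hA.angle_right_le
  exact Real.sin_nonneg_of_nonneg_of_le_pi (by linarith) (by linarith)

/-- If no vertex of `K` sits at an end of the arc, let `v` be a vertex of `K` at the smallest angle
`α`. Its only neighbour at a smaller angle is `a`, and balance at `v` restricts the angles to the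
other neighbours, hence the angles to the neighbours of every vertex. -/
theorem degree_le_two_of_interior {κ : Type*} {c : V → V → κ} (hA : G.IsArc a b K E φ)
    (hc : IsCoherentColouring c)
    (hadj : IsColourConstant c G.Adj) (hE : IsColourConstant c E) {d : ℕ}
    (hd : ∀ v, G.degree v = d) (hK : G.IsPairComponent a b K)
    (hne : ∀ v, ∃ w, G.Adj v w ∧ E v w ≠ 1) (hint : ∀ v ∈ K, 0 < φ v ∧ φ v < φ b) :
    d ≤ 2 := by
  classical
  by_contra! hd3
  have hpi := hA.angle_right_le
  have ha0 := hA.angle_left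
  have hmem : ∀ v ∈ K, ∀ w, G.Adj v w → w ∈ K ∨ w = a ∨ w = b := hK.mem_of_adj
  have hcard : ∀ v u u' : V, ∃ w, G.Adj v w ∧ w ≠ u ∧ w ≠ u' := by
    intro v u u'
    by_contra! h
    have h1 : G.neighborFinset v ⊆ {u, u'} := fun w hw => by
      rw [mem_neighborFinset] at hw
      by_cases hwu : w = u
      · simp [hwu]
      · simp [h w hw hwu]
    have h2 := (Finset.card_le_card h1).trans Finset.card_le_two
    rw [card_neighborFinset_eq_degree, hd] at h2
    omega
  have hE1 : ∀ u v : V, (u ∈ K ∨ u = a ∨ u = b) → (v ∈ K ∨ v = a ∨ v = b) →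
      φ u = φ v → E u v = 1 := by
    intro u v hu hv h
    rw [hA.eq_cos u v hu hv, h, sub_self, Real.cos_zero]
  obtain ⟨v, hv, hmin⟩ := K.exists_min_image φ hK.nonempty
  set α := φ v with hα
  have hα0 : 0 < α := (hint v hv).1
  have hαpi : α < Real.pi := (hint v hv).2.trans_le hpi
  have hge : ∀ u, (u ∈ K ∨ u = a ∨ u = b) → u ≠ a → α ≤ φ u := by
    rintro u (hu | hu | rfl) hua
    · exact hmin u hu
    · exact absurd hu hua
    · exact (hint v hv).2.le
  -- Every vertex at the smallest angle is adjacent to `a`.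
  have hadja : ∀ x ∈ K, φ x = α → G.Adj x a := by
    intro x hx hxα
    obtain ⟨w, hw, hlt⟩ := hA.exists_adj_angle_lt hK hint hne hx
    have : w = a := by
      by_contra hwa
      have := hge w (hmem x hx w hw) hwa
      linarith
    rwa [← this]
  have hEa : ∀ x ∈ K, E a x = Real.cos (φ x) ∧ E x a = Real.cos (φ x) := by
    intro x hx
    rw [hA.eq_cos a x (by simp) (Or.inl hx), hA.eq_cos x a (Or.inl hx) (by simp), ha0, zero_sub,
      Real.cos_neg, sub_zero]
    exact ⟨rfl, rfl⟩
  have hva : G.Adj v a := hadja v hv rfl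
  have hterm : ∀ w ∈ (G.neighborFinset v).erase a, 0 ≤ Real.sin (φ w - α) := by
    intro w hw
    obtain ⟨hwa, hw⟩ := Finset.mem_erase.1 hw
    have hw' := hmem v hv w ((mem_neighborFinset _ _ _).1 hw)
    exact hA.sin_nonneg_of_le hv hw' (hge w hw' hwa)
  have hbal : Real.sin α = ∑ w ∈ (G.neighborFinset v).erase a, Real.sin (φ w - α) := by
    have := hA.sin_eq_sum_erase hv hva
    rwa [ha0, sub_zero] at this
  have htwo : ∀ u w, G.Adj v u → G.Adj v w → u ≠ a → w ≠ a → u ≠ w →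
      Real.sin (φ u - α) + Real.sin (φ w - α) ≤ Real.sin α := by
    intro u w hu hw hua hwa huw
    rw [hbal, ← Finset.sum_pair huw (f := fun x => Real.sin (φ x - α))]
    refine Finset.sum_le_sum_of_subset_of_nonneg ?_ fun x hx _ => hterm x hx
    intro x hx
    simp only [Finset.mem_insert, Finset.mem_singleton] at hx
    rcases hx with rfl | rfl <;> simp_all
  have hsinα : 0 < Real.sin α := Real.sin_pos_of_pos_of_lt_pi hα0 hαpi
  have hccα : IsColourConstant c fun x w => G.Adj x w ∧ E x w = Real.cos α :=
    hadj.comp₂ hE fun p r => p ∧ r = Real.cos α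
  have hcc1 : IsColourConstant c fun x w => G.Adj x w ∧ E x w = 1 :=
    hadj.comp₂ hE fun p r => p ∧ r = 1
  by_cases hζ : ∃ w, G.Adj v w ∧ E v w = 1
  · -- A neighbour `v₂` of `v` at the same angle is also adjacent to `a`, so `v` and `v₂` are
    -- the only neighbours of `a` at angle `α`. The edge between `v` and `a` lies in a
    -- triangle that has no counterpart at `a`.
    obtain ⟨v₂, hv₂, hE₂⟩ := hζ
    have hφ₂ : φ v₂ = α := (hA.angle_eq (Or.inl hv) (hmem v hv v₂ hv₂) hE₂).symm
    have hv₂K : v₂ ∈ K := by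
      rcases hmem v hv v₂ hv₂ with h | rfl | rfl
      · exact h
      · rw [ha0] at hφ₂
        exact absurd hφ₂ hα0.ne
      · exact absurd hφ₂ (hint v hv).2.ne'
    have hv₂a := hadja v₂ hv₂K hφ₂
    have hcardv : (Finset.univ.filter fun w => G.Adj v w ∧ E v w = Real.cos α).card ≤ 2 := by
      by_contra! h
      obtain ⟨u, hu, w, hw, huw⟩ := Finset.one_lt_card.1
        (lt_of_lt_of_le (show 1 < 3 - 1 by norm_num) ((Nat.sub_le_sub_right h 1).trans
          (Finset.pred_card_le_card_erase (a := a))))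
      simp only [Finset.mem_erase, Finset.mem_filter, Finset.mem_univ, true_and] at hu hw
      have hang : ∀ x, x ≠ a → G.Adj v x → E v x = Real.cos α → φ x - α = α := by
        intro x hxa hx hEx
        have h1 := hA.abs_sub_eq (Or.inl hv) (hmem v hv x hx) hα0.le hαpi.le hEx
        have h2 := hge x (hmem v hv x hx) hxa
        rw [← hα, abs_of_nonpos (by linarith)] at h1
        linarith
      have := htwo u w hu.2.1 hw.2.1 hu.1 hw.1 huw
      rw [hang u hu.1 hu.2.1 hu.2.2, hang w hw.1 hw.2.1 hw.2.2] at this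
      linarith
    have hcarda : (Finset.univ.filter fun w => G.Adj a w ∧ E a w = Real.cos α).card ≤ 2 := by
      convert hcardv using 1
      convert hccα.card_filter_eq hc a v
    have hpair : (Finset.univ.filter fun w => G.Adj a w ∧ E a w = Real.cos α) = {v, v₂} := by
      symm
      refine Finset.eq_of_subset_of_card_le ?_ (by rwa [Finset.card_pair hv₂.ne])
      intro x hx
      simp only [Finset.mem_insert, Finset.mem_singleton] at hx
      rcases hx with rfl | rfl
      · simpa using ⟨hva.symm, (hEa _ hv).1⟩
      · simpa using ⟨hv₂a.symm, by rw [(hEa _ hv₂K).1, hφ₂]⟩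
    have htri : IsColourConstant c fun x y => (G.Adj x y ∧ E x y = Real.cos α) ∧
        ∃ z, (G.Adj x z ∧ E x z = 1) ∧ (G.Adj z y ∧ E z y = Real.cos α) :=
      hccα.comp₂ (hcc1.exists_and hc hccα) And
    obtain ⟨y, hy, z, ⟨haz, hEz⟩, hzy, -⟩ := htri.exists_of_exists hc (v := v)
      ⟨a, ⟨hva, (hEa v hv).2⟩, v₂, ⟨hv₂, hE₂⟩, hv₂a, by rw [(hEa v₂ hv₂K).2, hφ₂]⟩ a
    have hyK : y ∈ K := by
      have h1 : y ∈ ({v, v₂} : Finset V) := by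
        rw [← hpair]
        simpa using hy
      simp only [Finset.mem_insert, Finset.mem_singleton] at h1
      rcases h1 with rfl | rfl <;> assumption
    have hz := hmem y hyK z hzy.symm
    have hφz := hA.angle_eq (by simp) hz hEz
    rw [ha0] at hφz
    rcases hz with hz | rfl | rfl
    · exact (hint z hz).1.ne hφz
    · exact G.irrefl haz
    · exact ((hint v hv).1.trans (hint v hv).2).ne hφz
  · -- No two adjacent vertices are at angle zero. Then `a` is the only neighbour of `v` at angle
    -- `α` and all others are nearer; the same holds at each vertex.
    have hE_ne : ∀ x w, G.Adj x w → E x w ≠ 1 := fun x w hw h1 =>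
      hζ (hcc1.exists_of_exists hc ⟨w, hw, h1⟩ v)
    have hgt : ∀ w, G.Adj v w → w ≠ a → α < φ w := by
      intro w hw hwa
      have hw' := hmem v hv w hw
      refine lt_of_le_of_ne (hge w hw' hwa) fun h => ?_
      exact hE_ne v w hw (hE1 v w (Or.inl hv) hw' h)
    have hsinpos : ∀ w, G.Adj v w → w ≠ a → 0 < Real.sin (φ w - α) := by
      intro w hw hwa
      have h1 := hA.mem_Icc (hmem v hv w hw)
      exact Real.sin_pos_of_pos_of_lt_pi (sub_pos.2 (hgt w hw hwa)) (by linarith)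
    have hsinlt : ∀ w, G.Adj v w → w ≠ a → Real.sin (φ w - α) < Real.sin α := by
      intro w hw hwa
      obtain ⟨w', hw', hwa', hne'⟩ := hcard v a w
      have := htwo w w' hw hw' hwa hwa' hne'.symm
      linarith [hsinpos w' hw' hwa']
    have hnear : ∀ w, G.Adj v w → w ≠ a → φ w - α < α := by
      intro w hw hwa
      have h1 := hA.mem_Icc (hmem v hv w hw)
      exact Real.lt_of_sin_lt_sin_of_add_le_pi hα0.le (by linarith) (hsinlt w hw hwa)
    have hcosgt : ∀ w, G.Adj v w → w ≠ a → Real.cos α < E v w := by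
      intro w hw hwa
      rw [hA.eq_cos v w (Or.inl hv) (hmem v hv w hw),
        ← Real.cos_neg (φ v - φ w), neg_sub]
      exact Real.cos_lt_cos_of_nonneg_of_le_pi (sub_nonneg.2 (hgt w hw hwa).le) hαpi.le
        (hnear w hw hwa)
    have huniq : ∀ x w w', (G.Adj x w ∧ E x w = Real.cos α) →
        (G.Adj x w' ∧ E x w' = Real.cos α) → w = w' := by
      refine fun x => hccα.unique_of_unique hc (v := v) ?_ x
      have h1 : ∀ w, (G.Adj v w ∧ E v w = Real.cos α) → w = a := fun w hw => by
        by_contra hwa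
        exact (hcosgt w hw.1 hwa).ne' hw.2
      exact fun w w' hw hw' => (h1 w hw).trans (h1 w' hw').symm
    have hfar : ∀ x w, G.Adj x w → Real.cos α ≤ E x w := by
      by_contra! h
      obtain ⟨x, w, hw, hlt⟩ := h
      obtain ⟨u, hu, hult⟩ := IsColourConstant.exists_of_exists hc
        (hadj.comp₂ hE fun p r => p ∧ r < Real.cos α) ⟨w, hw, hlt⟩ v
      by_cases hua : u = a
      · rw [hua, (hEa v hv).2] at hult
        exact lt_irrefl _ hult
      · exact lt_asymm (hcosgt u hu hua) hult
    obtain ⟨w₀, hw₀, hw₀a, hw₀b⟩ := hcard v a b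
    have hw₀K : w₀ ∈ K := (hmem v hv w₀ hw₀).resolve_right (not_or.2 ⟨hw₀a, hw₀b⟩)
    -- Let `w` be at the second smallest angle.
    obtain ⟨w, hwE, hwmin⟩ := (K.erase v).exists_min_image φ
      ⟨w₀, Finset.mem_erase.2 ⟨hw₀.ne', hw₀K⟩⟩
    obtain ⟨hwv, hw⟩ := Finset.mem_erase.1 hwE
    have hwgt : α < φ w := by
      refine lt_of_le_of_ne (hmin w hw) fun h => hwv ?_
      exact huniq a w v ⟨(hadja w hw h.symm).symm, by rw [(hEa w hw).1, ← h]⟩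
        ⟨hva.symm, (hEa v hv).1⟩
    have hwpi : φ w ≤ Real.pi := (hint w hw).2.le.trans hpi
    have hwa : ¬ G.Adj w a := by
      intro h
      have h1 := hfar w a h
      rw [(hEa w hw).2] at h1
      exact absurd (Real.cos_lt_cos_of_nonneg_of_le_pi hα0.le hwpi hwgt) (not_lt.2 h1)
    have hleft : ∀ u, G.Adj w u → φ u < φ w → u = v := by
      intro u hu hlt
      rcases hmem w hw u hu with h | rfl | rfl
      · by_contra huv
        exact absurd (hwmin u (Finset.mem_erase.2 ⟨huv, h⟩)) (not_le.2 hlt)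
      · exact absurd hu hwa
      · exact absurd hlt (hint w hw).2.not_gt
    have hwv' : G.Adj w v := by
      obtain ⟨u, hu, hlt⟩ := hA.exists_adj_angle_lt hK hint hne hw
      rwa [← hleft u hu hlt]
    have hwna : w ≠ a := by
      rintro rfl
      exact hK.left_notMem hw
    -- The neighbour of `w` at angle `α` is on the far side, and is too far to be balanced by `v`.
    obtain ⟨u, hu, hEu⟩ := hccα.exists_of_exists hc ⟨a, hva, (hEa v hv).2⟩ w
    have huK := hmem w hw u hu
    have habs := hA.abs_sub_eq (Or.inl hw) huK hα0.le hαpi.le hEu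
    have hle : φ w ≤ φ u := by
      by_contra! hlt
      have huv := hleft u hu hlt
      rw [huv, ← hα, abs_of_pos (sub_pos.2 hwgt)] at habs
      exact (hnear w hwv'.symm hwna).ne habs
    rw [abs_of_nonpos (sub_nonpos.2 hle), neg_sub] at habs
    have huv : u ≠ v := by
      rintro rfl
      linarith
    have hbalw := hA.sin_eq_sum_erase hw hwv'
    have h1 : Real.sin (φ u - φ w) ≤ Real.sin (φ w - φ v) := by
      rw [hbalw]
      refine Finset.single_le_sum (f := fun x => Real.sin (φ x - φ w)) (fun x hx => ?_)
        (Finset.mem_erase.2 ⟨huv, (mem_neighborFinset _ _ _).2 hu⟩)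
      obtain ⟨hxv, hx⟩ := Finset.mem_erase.1 hx
      rw [mem_neighborFinset] at hx
      refine hA.sin_nonneg_of_le hw (hmem w hw x hx) ?_
      by_contra! hlt
      exact hxv (hleft x hx hlt)
    rw [habs] at h1
    exact absurd (hsinlt w hwv'.symm hwna) (not_lt.2 h1)

end IsArc

/-! ### The dichotomy -/

theorem degree_le_two_of_isPairComponent {κ : Type*} {c : V → V → κ}
    (hc : IsCoherentColouring c) (hadj : IsColourConstant c G.Adj) (hG : G.Connected) {d : ℕ}
    (hd : ∀ v, G.degree v = d) {H : Type*} [NormedAddCommGroup H] [InnerProductSpace ℝ H]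
    {θ : ℝ} {e : V → H} (he : G.IsSpectralEmbedding θ e)
    (hE : IsColourConstant c fun v w => (inner ℝ (e v) (e w) : ℝ)) {a b : V} (hab : a ≠ b)
    {K : Finset V} (hK : G.IsPairComponent a b K) (hray : G.RayleighLE K θ) : d ≤ 2 := by
  have hA := he.isArc hG hab hK hray
  have hne : ∀ v, ∃ w, G.Adj v w ∧ (inner ℝ (e v) (e w) : ℝ) ≠ 1 := by
    by_contra! h
    obtain ⟨v₀, hv₀⟩ := h
    have h1 : ∀ v w, G.Adj v w → (inner ℝ (e v) (e w) : ℝ) = 1 := by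
      by_contra! h
      obtain ⟨v, w, hw, hvw⟩ := h
      obtain ⟨u, hu, hu1⟩ := IsColourConstant.exists_of_exists hc
        (hadj.comp₂ hE fun p r => p ∧ r ≠ 1) ⟨w, hw, hvw⟩ v₀
      exact hu1 (hv₀ u hu)
    have h2 : ∀ v, e v = e v₀ := hG.forall_of_adj (T := fun v => e v = e v₀) rfl
      fun v w hv hvw => (he.eq_of_inner_eq_one (h1 v w hvw)).symm.trans hv
    have h3 := he.sum_eq_zero
    rw [Finset.sum_congr rfl fun v _ => h2 v, Finset.sum_const,
      ← Nat.cast_smul_eq_nsmul ℝ, smul_eq_zero, Nat.cast_eq_zero] at h3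
    rcases h3 with h3 | h3
    · exact (Finset.card_pos.2 ⟨v₀, Finset.mem_univ _⟩).ne' h3
    · have := he.norm_eq v₀
      rw [h3, norm_zero] at this
      exact zero_ne_one this
  have hθ : ∀ v, ∑ w ∈ G.neighborFinset v, (inner ℝ (e v) (e w) : ℝ) = θ := by
    intro v
    rw [← inner_sum, he.sum_neighbor, real_inner_smul_right, he.inner_self, mul_one]
  by_cases h : ∃ v ∈ K, IsSpectralEmbedding.angle e a v = 0 ∨
      IsSpectralEmbedding.angle e a v = IsSpectralEmbedding.angle e a b
  · obtain ⟨v, hv, h⟩ := h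
    exact hA.degree_le_two_of_endpoint hc hadj hE hd hK hab hray hθ hne hv h
  · push Not at h
    exact hA.degree_le_two_of_interior hc hadj hE hd hK hne fun v hv =>
      ⟨lt_of_le_of_ne (hA.angle_nonneg v hv) (h v hv).1.symm,
        lt_of_le_of_ne (hA.angle_le v hv) (h v hv).2⟩

end SimpleGraph

/-- A connected graph whose adjacency relation is constant on the colours of a homogeneous coherent
colouring is 3-connected or a cycle of length at least four. -/
theorem SimpleGraph.Connected.isThreeConnected_or_isCycle {V : Type*} [Fintype V]
    {G : SimpleGraph V} {κ : Type*} {c : V → V → κ} (hG : G.Connected)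
    (hc : IsCoherentColouring c) (hadj : IsColourConstant c G.Adj) :
    G.IsThreeConnected ∨ G.IsCycleOfLengthGeFour := by
  classical
  rcases Nat.lt_or_ge 3 (Fintype.card V) with h4 | h3
  swap
  · exact Or.inl (hG.isThreeConnected_of_card_le_three h3)
  obtain ⟨v₀⟩ := hG.nonempty
  obtain ⟨d, hd⟩ : ∃ d, ∀ v, G.degree v = d := by
    refine ⟨G.degree v₀, fun v => ?_⟩
    have := hadj.card_filter_eq hc v v₀
    rw [← SimpleGraph.card_neighborFinset_eq_degree, ← SimpleGraph.card_neighborFinset_eq_degree,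
      SimpleGraph.neighborFinset_eq_filter, SimpleGraph.neighborFinset_eq_filter]
    convert this
  have hd2 : 2 ≤ d := by
    by_contra! h
    have := hG.card_le_two_of_degree_le_one fun v => by rw [hd]; omega
    omega
  rcases hd2.eq_or_lt with rfl | hd3
  · obtain ⟨l, -, ⟨f⟩⟩ := hG.exists_iso_cycleGraph hd
    have hl := Fintype.card_congr f.toEquiv
    rw [Fintype.card_fin] at hl
    exact Or.inr ⟨l, by omega, ⟨f⟩⟩
  · left
    by_contra h3
    obtain ⟨a, b, hab, K, L, hK, hL, hKL⟩ := hG.exists_isPairComponent h3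
    obtain ⟨θ, e, he, hE⟩ := SimpleGraph.exists_isSpectralEmbedding hc hadj hd (by omega)
    rcases hK.rayleighLE_or hL hKL he.rayleigh with h | h
    · have := SimpleGraph.degree_le_two_of_isPairComponent hc hadj hG hd he hE hab hK h
      omega
    · have := SimpleGraph.degree_le_two_of_isPairComponent hc hadj hG hd he hE hab hL h
      omega

theorem mainTheorem1 {V : Type*} [Fintype V] :
    (∀ G : SimpleGraph V,
      (∀ u v : V, G.wlStableColor u u = G.wlStableColor v v) →
        (¬ G.Connected ∨ G.IsThreeConnected ∨ G.IsCycleOfLengthGeFour) ∧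
        ¬ (¬ G.Connected ∧ G.IsThreeConnected) ∧
        ¬ (¬ G.Connected ∧ G.IsCycleOfLengthGeFour) ∧
        ¬ (G.IsThreeConnected ∧ G.IsCycleOfLengthGeFour)) ∧
    (∀ (d : ℕ) (A : AssociationScheme V d) (i : Fin (d + 1)),
      (A.constituentGraph i).Connected →
        (A.constituentGraph i).IsThreeConnected ∨
          (A.constituentGraph i).IsCycleOfLengthGeFour) := by
  classical
  refine ⟨fun G hχ => ⟨?_, fun h => h.1 h.2.1, ?_, ?_⟩, fun d A i hG => ?_⟩
  · by_cases hG : G.Connected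
    · exact Or.inr (hG.isThreeConnected_or_isCycle (G.isCoherentColouring_wlStableColor hχ)
        G.isColourConstant_adj_wlStableColor)
    · exact Or.inl hG
  · rintro ⟨hG, l, hl, ⟨f⟩⟩
    obtain ⟨m, rfl⟩ : ∃ m, l = m + 1 := ⟨l - 1, by omega⟩
    exact hG (f.connected_iff.2 SimpleGraph.cycleGraph_connected)
  · rintro ⟨h3, l, hl, ⟨f⟩⟩
    obtain ⟨m, rfl⟩ : ∃ m, l = m + 3 := ⟨l - 3, by omega⟩
    refine SimpleGraph.not_isThreeConnected_of_degree_eq_two (v := f.symm 0) ?_ ?_ h3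
    · rw [f.symm.degree_eq, SimpleGraph.cycleGraph_degree_three_le]
    · rw [Fintype.card_congr f.toEquiv, Fintype.card_fin]
      exact hl
  · exact hG.isThreeConnected_or_isCycle A.isCoherentColouring_index
      (A.isColourConstant_constituentGraph_adj i)
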